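/- **Setting.** Let $\mathcal B_n=\{-1,1\}^n$, $f:\mathcal B_n\to\mathbb R$, $T:\mathcal B_n\to\mathcal B_n$ (the filter function), $\lambda\ge 0$, and let $B$ be a bound with $|f(T(x))|\le B$ for all $x$. Let $p_\theta$, $\theta\in\mathbb R^d$, be a family of probability mass functions on $\mathcal B_n$ with $p_\theta(x)>0$, and put $$L_\lambda(\theta)=\mathbb E_{p_\theta}[f(T(x))]+\lambda\,\mathbb E_{p_\theta}[\log p_\theta(x)].$$ Assume that $\theta\mapsto\log p_\theta(x)$ is differentiable for every $x$ and that there are $M_1,M_2,M_3>0$ with $$|\log p_\theta(x)|\le M_1,\qquad \|\nabla_\theta\log p_\theta(x)\|\le M_2,\qquad \|\nabla_\theta\log p_{\theta_1}(x)-\nabla_\theta\log p_{\theta_2}(x)\|\le M_3\|\theta_1-\theta_2\|$$ for all $x,\theta,\theta_1,\theta_2$. Let $Q(x'|x)$ be a proposal distribution and $P_\theta$ the Metropolis–Hastings transition matrix with target $p_\theta$ and proposal $Q$ (acceptance probability $\min\{1,\,p_\theta(x')Q(x|x')/(p_\theta(x)Q(x'|x))\}$). Let $\lambda_i(P)$ be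 the $i$-th largest eigenvalue of $P$, $\gamma(P)=\frac12\left(1-\max\{|\lambda_2(P)|,|\lambda_{2^n}(P)|\}\right)$ its spectral gap, and assume $\gamma(P_\theta)\ge\gamma$ for all $\theta$, for some $\gamma>0$. **MCPG.** Let $k,m\ge1$, $b\ge0$ be integers. At iteration $t=1,2,\dots$, given the past (including $\theta^t$ and $k$ starting points in $\mathcal B_n$, which may be any random points determined by the past, e.g. the best filtered samples of the previous iteration), run $k$ independent Markov chains with transition matrix $P_{\theta^t}$ from these starting points, discard the first $b$ states of each chain (the starting point counting as the first state) and retain the next $m$ states $s_i^1,\dots,s_i^m$, $1\le i\le k$. The parameter is updated by $$\theta^{t+1}=\theta^t-\frac{\eta^t}{km}\sum_{i,j}\Big(f(T(s_i^j))+\lambda\log p_{\theta^t}(s_i^j)-\frac1{km}\sum_{u,v}f(T(s_u^v))\Big)\nabla_\theta\log p_{\theta^t}(s_i^j).$$ The initial parameter $\theta^1$ may be random. **Theorem.** There is $l>0$, depending only on $n,d,M_1,M_2,M_3,B,\lambda$, such that $L_\lambda$ is $l$-smooth, i.e. differentiable with $\|\nabla L_\lambda(\theta_1)-\nabla L_\lambda(\theta_2)\|\le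 l\|\theta_1-\theta_2\|$ for all $\theta_1,\theta_2$. Moreover, let $l>0$ be any constant for which $L_\lambda$ is $l$-smooth. 1. There is a constant $C$, depending only on $n,d,M_1,M_2,M_3,B,\lambda,\gamma,l$, such that if $0<\eta^t\le\frac1{2l}$ for all $t\ge 1$, then for all $\tau\ge1$ $$\min_{1\le t\le\tau}\mathbb E\|\nabla L_\lambda(\theta^t)\|^2\le C\left(\frac1{\sum_{t=1}^\tau\eta^t}+\frac{\sum_{t=1}^\tau(\eta^t)^2}{mk\sum_{t=1}^\tau\eta^t}+\frac1{m^2}\right).$$ 2. For every $0<c\le\frac1{2l}$ there is a constant $K$, depending only on $c$ and on the quantities in 1, such that if $\eta^t=c\sqrt{mk}/\sqrt t$ for all $t\ge 1$, then for all $\tau\ge2$ with $\tau\ge 8l^2c^2mk$ (in particular, for all $\tau\ge2mk$; and for all $\tau\ge 2$ if $\eta^1=c\sqrt{mk}\le\frac1{2l}$) $$\min_{1\le t\le\tau}\mathbb E\|\nabla L_\lambda(\theta^t)\|^2\le K\left(\frac{\log\tau}{\sqrt{mk\tau}}+\frac1{m^2}\right).$$ -/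

import Mathlib

open MeasureTheory

noncomputable section

/-- The binary set `{-1,1}^n` (the units of `ℤ` are exactly `1` and `-1`). -/
abbrev Cube (n : ℕ) : Type := Fin n → ℤˣ

/-- The parameter space `ℝ^d` with its Euclidean norm. -/
abbrev Param (d : ℕ) : Type := EuclideanSpace ℝ (Fin d)

/-- `p θ` is a positive probability mass function on the cube for each parameter `θ`, and
`log p θ x` is differentiable in `θ`, bounded by `M₁`, with gradient bounded by `M₂` and
`M₃`-Lipschitz, uniformly in `x`. -/
structure RegularPolicy {n d : ℕ} (p : Param d → Cube n → ℝ) (M₁ M₂ M₃ : ℝ) : Prop where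
  pos : ∀ θ x, 0 < p θ x
  sum_eq_one : ∀ θ, ∑ x, p θ x = 1
  differentiable : ∀ x, Differentiable ℝ (fun θ => Real.log (p θ x))
  abs_log_le : ∀ x θ, |Real.log (p θ x)| ≤ M₁
  norm_gradient_le : ∀ x θ, ‖gradient (fun θ' => Real.log (p θ' x)) θ‖ ≤ M₂
  gradient_lipschitz : ∀ x θ₁ θ₂,
    ‖gradient (fun θ' => Real.log (p θ' x)) θ₁ - gradient (fun θ' => Real.log (p θ' x)) θ₂‖
      ≤ M₃ * ‖θ₁ - θ₂‖

/-- The loss `L_λ(θ) = E_{p_θ}[f(T(x))] + λ E_{p_θ}[log p_θ(x)]`. -/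
def loss {n d : ℕ} (f : Cube n → ℝ) (T : Cube n → Cube n) (p : Param d → Cube n → ℝ)
    (lam : ℝ) (θ : Param d) : ℝ :=
  ∑ x, p θ x * f (T x) + lam * ∑ x, p θ x * Real.log (p θ x)

/-- `F` is `l`-smooth: differentiable with `l`-Lipschitz gradient. -/
def IsSmoothWith {d : ℕ} (l : ℝ) (F : Param d → ℝ) : Prop :=
  Differentiable ℝ F ∧ ∀ θ₁ θ₂, ‖gradient F θ₁ - gradient F θ₂‖ ≤ l * ‖θ₁ - θ₂‖

/-- `Q x y` is the probability of proposing `y` from the state `x`. -/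
structure IsProposal {n : ℕ} (Q : Matrix (Cube n) (Cube n) ℝ) : Prop where
  nonneg : ∀ x y, 0 ≤ Q x y
  sum_eq_one : ∀ x, ∑ y, Q x y = 1

/-- The Metropolis-Hastings probability of accepting the proposed state `y` at the state `x`,
for the target distribution `q` and the proposal `Q`. -/
def mhAccept {n : ℕ} (q : Cube n → ℝ) (Q : Matrix (Cube n) (Cube n) ℝ) (x y : Cube n) : ℝ :=
  min 1 ((q y * Q y x) / (q x * Q x y))

/-- The Metropolis-Hastings transition matrix: off the diagonal, propose and accept; the
diagonal entry collects the remaining probability. -/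
def mhMatrix {n : ℕ} (q : Cube n → ℝ) (Q : Matrix (Cube n) (Cube n) ℝ) :
    Matrix (Cube n) (Cube n) ℝ :=
  fun x y =>
    if x = y then 1 - ∑ z ∈ Finset.univ.erase x, Q x z * mhAccept q Q x z
    else Q x y * mhAccept q Q x y

/-- The `i`-th largest (`i ≥ 1`) real eigenvalue, counted with multiplicity, of a real matrix on
the cube. Metropolis-Hastings matrices are reversible, so all their eigenvalues are real and there
are `2 ^ n` of them. -/
def nthEigenvalue {n : ℕ} (P : Matrix (Cube n) (Cube n) ℝ) (i : ℕ) : ℝ :=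
  (P.charpoly.roots.sort (fun a b => b ≤ a)).getD (i - 1) 0

/-- The spectral gap `(1 - max {|λ₂(P)|, |λ_{2^n}(P)|}) / 2` of a transition matrix. -/
def spectralGap {n : ℕ} (P : Matrix (Cube n) (Cube n) ℝ) : ℝ :=
  (1 - max |nthEigenvalue P 2| |nthEigenvalue P (2 ^ n)|) / 2

/-- The probability that the first `N` states (starting state included) of a Markov chain with
transition matrix `P` started at `x₀` are `y 0, …, y (N - 1)`. -/
def pathProb {n : ℕ} (P : Matrix (Cube n) (Cube n) ℝ) (x₀ : Cube n) :
    (N : ℕ) → (Fin N → Cube n) → ℝ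
  | 0, _ => 1
  | N + 1, y => (if y 0 = x₀ then 1 else 0) * ∏ v : Fin N, P (y v.castSucc) (y v.succ)

/-- The advantage `f(T(x)) + λ log p_θ(x) - (1/(km)) ∑_{u,v} f(T(S_u^v))` of `x` relative to the
sample array `S`. -/
def advantage {n d k m : ℕ} (f : Cube n → ℝ) (T : Cube n → Cube n) (p : Param d → Cube n → ℝ)
    (lam : ℝ) (θ : Param d) (S : Fin k → Fin m → Cube n) (x : Cube n) : ℝ :=
  f (T x) + lam * Real.log (p θ x) - (1 / ((k : ℝ) * m)) * ∑ u, ∑ v, f (T (S u v))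

/-- The stochastic policy gradient computed from the sample array `S`. -/
def policyGradient {n d k m : ℕ} (f : Cube n → ℝ) (T : Cube n → Cube n)
    (p : Param d → Cube n → ℝ) (lam : ℝ) (θ : Param d) (S : Fin k → Fin m → Cube n) : Param d :=
  (1 / ((k : ℝ) * m)) • ∑ i, ∑ j,
    advantage f T p lam θ S (S i j) • gradient (fun θ' => Real.log (p θ' (S i j))) θ

/-- A run of MCPG (iterations `t = 1, 2, …`) on a filtered probability space, with `k` chains,
`b` discarded warm-up states and `m` retained states per chain, proposal `Q` and step sizes `η`.

`θ t` is the parameter and `s t i` the starting point of chain `i` at iteration `t`; `X t i` lists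
the `b + m` successive states of that chain. Given the past `ℱ t`, the `k` chains are independent
Metropolis-Hastings chains with target `p_{θ t}` started at `s t i`. The parameter is then updated
with the policy gradient of the last `m` states of every chain. The starting points may be any
random points known at the beginning of the iteration (the best filtered samples of the previous
iteration, fresh draws from a distribution, …), and the initial parameter may be random. -/
structure IsMCPGRun {n d : ℕ} (f : Cube n → ℝ) (T : Cube n → Cube n)
    (p : Param d → Cube n → ℝ) (lam : ℝ) (Q : Matrix (Cube n) (Cube n) ℝ) (k m b : ℕ)
    (η : ℕ → ℝ) {Ω : Type*} [mΩ : MeasurableSpace Ω] (μ : Measure Ω) (ℱ : Filtration ℕ mΩ)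
    (θ : ℕ → Ω → Param d) (s : ℕ → Ω → Fin k → Cube n)
    (X : ℕ → Ω → Fin k → Fin (b + m) → Cube n) : Prop where
  measurable_param : ∀ t, 1 ≤ t → Measurable[ℱ t] (θ t)
  measurable_start : ∀ t, 1 ≤ t → ∀ y, MeasurableSet[ℱ t] {ω | s t ω = y}
  measurable_chains : ∀ t, 1 ≤ t → ∀ y, MeasurableSet[ℱ (t + 1)] {ω | X t ω = y}
  chains_law : ∀ t, 1 ≤ t → ∀ y : Fin k → Fin (b + m) → Cube n,
    μ[Set.indicator {ω | X t ω = y} (fun _ => (1 : ℝ)) | ℱ t] =ᵐ[μ]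
      fun ω => ∏ i, pathProb (mhMatrix (p (θ t ω)) Q) (s t ω i) (b + m) (y i)
  update : ∀ t, 1 ≤ t → ∀ ω, θ (t + 1) ω = θ t ω -
    η t • policyGradient f T p lam (θ t ω) (fun i (j : Fin m) => X t ω i (Fin.natAdd b j))

/-- `min_{1 ≤ t ≤ τ} E ‖∇ F(θ^t)‖²`. -/
def minExpSqGrad {d : ℕ} (F : Param d → ℝ) {Ω : Type*} [MeasurableSpace Ω] (μ : Measure Ω)
    (θ : ℕ → Ω → Param d) (τ : ℕ) (hτ : 1 ≤ τ) : ℝ :=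
  (Finset.Icc 1 τ).inf' (Finset.nonempty_Icc.mpr hτ)
    (fun t => ∫ ω, ‖gradient F (θ t ω)‖ ^ 2 ∂μ)

end

open MeasureTheory

noncomputable section

/-! MCPG is stochastic gradient descent with a biased estimator, so the task is to bound the bias
and the mean squared error of one policy gradient, conditionally on the past, and to feed both into
the descent lemma.

Since the score has mean zero under `p θ`, the gradient of the loss is the `p θ`-mean of `u = (f ∘ T
+ λ log p) • score`. Each coordinate of the estimator is `avg u - avg F * avg g`, where `F = f ∘ T`
and `g` is a coordinate of the score, hence centred.

The Metropolis–Hastings chain is reversible, so conjugation by `√q` makes its matrix symmetric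
without changing the eigenvalues. The gap then contracts centred functions in `L²(q)` by `1 - 2γ`.
As `q ≥ exp (-M₁)`, this becomes uniform decay from every starting point (`abs_pow_mulVec_le`).
Geometric series give a time average bias and mean squared error of order `1/m`; over `k`
independent chains the error is of order `1/(mk) + 1/m²`. The product `avg F * avg g` keeps these
orders: its bias comes from the correlation of two small fluctuations plus the bias of `avg g`.

If `l η ≤ 1/2`, one step lowers the expected loss by `η/4 · E‖∇L‖²`, up to `η · bias² + l η² · mse`
(`IsSmoothWith.sum_mul_step_le`). The `1/m²` share of the second error is absorbed into `η/m²`. The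
loss is bounded, so telescoping over a window of iterations gives the first rate
(`minExpSqGrad_le_of_window`).

For `η t` proportional to `1/√t` the early steps may be too long for the descent lemma. A minimum
over a subwindow dominates the full minimum, so only the second half of the iterations is used.
There the steps are short and comparable to the last one. The resulting bound is of order
`1/√(mkτ)`; the logarithm enters only through `log τ ≥ 1/2`. -/

/-! ### Symmetric matrices with one exceptional eigenvalue. -/

theorem Matrix.IsHermitian.dotProduct_eigenvectorBasis_mulVec {ι : Type*} [Fintype ι]
    [DecidableEq ι] {A : Matrix ι ι ℝ} (hA : A.IsHermitian) (i : ι) (v : ι → ℝ) :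
    hA.eigenvectorBasis i ⬝ᵥ A.mulVec v = hA.eigenvalues i * (hA.eigenvectorBasis i ⬝ᵥ v) := by
  have h : A.IsSymm := by simpa using hA
  rw [Matrix.dotProduct_mulVec, ← Matrix.mulVec_transpose, h.eq, hA.mulVec_eigenvectorBasis,
    smul_dotProduct, smul_eq_mul]

theorem OrthonormalBasis.sum_dotProduct_sq {ι : Type*} [Fintype ι]
    (b : OrthonormalBasis ι ℝ (EuclideanSpace ℝ ι)) (v : ι → ℝ) :
    ∑ i, (b i ⬝ᵥ v) ^ 2 = v ⬝ᵥ v := by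
  have h := b.sum_sq_norm_inner_right (WithLp.toLp 2 v)
  simp only [EuclideanSpace.inner_eq_star_dotProduct, EuclideanSpace.real_norm_sq_eq] at h
  simpa [dotProduct_comm _ v, dotProduct, pow_two, mul_comm] using h

/-- If all eigenvalues but one have modulus at most `r < 1` and `w` is fixed by `A`, then `A`
contracts the orthogonal complement of `w` by the factor `r`. -/
theorem Matrix.IsHermitian.mulVec_dotProduct_self_le {ι : Type*} [Fintype ι]
    [DecidableEq ι] {A : Matrix ι ι ℝ} (hA : A.IsHermitian) {i₀ : ι} {r : ℝ} (hr : r < 1)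
    (hl : ∀ i, i ≠ i₀ → |hA.eigenvalues i| ≤ r) {w : ι → ℝ} (hw : w ≠ 0)
    (hAw : A.mulVec w = w) {v : ι → ℝ} (hv : w ⬝ᵥ v = 0) :
    A.mulVec v ⬝ᵥ A.mulVec v ≤ r ^ 2 * (v ⬝ᵥ v) := by
  -- A vector of eigenvalue `1` is orthogonal to every eigenvector with another eigenvalue, so `w`
  -- is a multiple of the eigenvector at `i₀`.
  have hwi : ∀ i, i ≠ i₀ → hA.eigenvectorBasis i ⬝ᵥ w = 0 := by
    intro i hi
    have h1 := hA.dotProduct_eigenvectorBasis_mulVec i w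
    rw [hAw] at h1
    have h2 : hA.eigenvalues i ≠ 1 := fun h => by
      have := hl i hi; rw [h, abs_one] at this; linarith
    have h3 : (hA.eigenvalues i - 1) * (hA.eigenvectorBasis i ⬝ᵥ w) = 0 := by linarith
    exact (mul_eq_zero.1 h3).resolve_left (sub_ne_zero.2 h2)
  have hw0 : hA.eigenvectorBasis i₀ ⬝ᵥ w ≠ 0 := by
    intro h0
    apply hw
    rw [← dotProduct_self_eq_zero, ← hA.eigenvectorBasis.sum_dotProduct_sq]
    refine Finset.sum_eq_zero fun i _ => ?_
    by_cases hi : i = i₀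
    · rw [hi, h0]; simp
    · rw [hwi i hi]; simp
  -- In the expansion of `w ⬝ᵥ v` along the eigenbasis only the term at `i₀` survives, and its
  -- factor from `w` is nonzero.
  have hv0 : hA.eigenvectorBasis i₀ ⬝ᵥ v = 0 := by
    have h1 := hA.eigenvectorBasis.sum_inner_mul_inner (WithLp.toLp 2 w) (WithLp.toLp 2 v)
    rw [Finset.sum_eq_single i₀] at h1
    · simp only [EuclideanSpace.inner_eq_star_dotProduct, star_trivial] at h1
      rw [dotProduct_comm v w, hv] at h1
      rcases mul_eq_zero.1 h1 with h | h
      · exact absurd h hw0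
      · rwa [dotProduct_comm]
    · intro i _ hi
      simp only [EuclideanSpace.inner_eq_star_dotProduct, star_trivial]
      rw [hwi i hi, zero_mul]
    · simp
  rw [← hA.eigenvectorBasis.sum_dotProduct_sq, ← hA.eigenvectorBasis.sum_dotProduct_sq,
    Finset.mul_sum]
  refine Finset.sum_le_sum fun i _ => ?_
  rw [hA.dotProduct_eigenvectorBasis_mulVec, mul_pow]
  by_cases hi : i = i₀
  · rw [hi, hv0]; simp
  · exact mul_le_mul_of_nonneg_right (by rw [← sq_abs]; gcongr; exact hl i hi) (sq_nonneg _)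

/-! ### Reversibility, symmetrization and the spectral gap. -/

/-- `P` is a transition matrix in detailed balance with the positive distribution `q`. -/
structure IsReversibleFor {ι : Type*} [Fintype ι] (q : ι → ℝ) (P : Matrix ι ι ℝ) : Prop where
  pos : ∀ x, 0 < q x
  sum_target : ∑ x, q x = 1
  nonneg : ∀ x y, 0 ≤ P x y
  sum_row : ∀ x, ∑ y, P x y = 1
  balance : ∀ x y, q x * P x y = q y * P y x

theorem mhAccept_nonneg {n : ℕ} {q : Cube n → ℝ} {Q : Matrix (Cube n) (Cube n) ℝ}
    (hq : ∀ x, 0 < q x) (hQ : IsProposal Q) (x y : Cube n) : 0 ≤ mhAccept q Q x y :=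
  le_min zero_le_one (div_nonneg (mul_nonneg (hq y).le (hQ.nonneg _ _))
    (mul_nonneg (hq x).le (hQ.nonneg _ _)))

/-- The right side is symmetric in `x` and `y`, which is detailed balance. If `Q x y = 0` the
acceptance ratio is a division by zero, but both sides vanish. -/
theorem mul_mhAccept {n : ℕ} {q : Cube n → ℝ} {Q : Matrix (Cube n) (Cube n) ℝ}
    (hq : ∀ x, 0 < q x) (hQ : IsProposal Q) (x y : Cube n) :
    q x * (Q x y * mhAccept q Q x y) = min (q x * Q x y) (q y * Q y x) := by
  unfold mhAccept
  rcases (hQ.nonneg x y).eq_or_lt with h | h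
  · rw [← h]
    simp [min_eq_left (mul_nonneg (hq y).le (hQ.nonneg y x))]
  · have h1 : 0 < q x * Q x y := mul_pos (hq x) h
    rw [← mul_assoc, mul_min_of_nonneg _ _ h1.le, mul_one, mul_div_cancel₀ _ h1.ne']

theorem isReversibleFor_mhMatrix {n : ℕ} {q : Cube n → ℝ} {Q : Matrix (Cube n) (Cube n) ℝ}
    (hq : ∀ x, 0 < q x) (hq1 : ∑ x, q x = 1) (hQ : IsProposal Q) :
    IsReversibleFor q (mhMatrix q Q) where
  pos := hq
  sum_target := hq1
  nonneg x y := by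
    unfold mhMatrix
    split_ifs
    · rw [sub_nonneg, ← hQ.sum_eq_one x]
      refine (Finset.sum_le_sum fun z _ => ?_).trans
        (Finset.sum_le_sum_of_subset_of_nonneg (Finset.erase_subset x _)
          fun z _ _ => hQ.nonneg x z)
      exact mul_le_of_le_one_right (hQ.nonneg _ _) (min_le_left _ _)
    · exact mul_nonneg (hQ.nonneg _ _) (mhAccept_nonneg hq hQ _ _)
  sum_row x := by
    rw [← Finset.add_sum_erase _ _ (Finset.mem_univ x)]
    have : ∑ y ∈ Finset.univ.erase x, mhMatrix q Q x y =
        ∑ z ∈ Finset.univ.erase x, Q x z * mhAccept q Q x z :=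
      Finset.sum_congr rfl fun y hy => by
        rw [mhMatrix, if_neg (Finset.ne_of_mem_erase hy).symm]
    rw [this, mhMatrix, if_pos rfl]
    ring
  balance x y := by
    by_cases h : x = y
    · rw [h]
    · rw [mhMatrix, mhMatrix, if_neg h, if_neg (Ne.symm h), mul_mhAccept hq hQ,
        mul_mhAccept hq hQ, min_comm]

/-- The symmetrization `√qₓ Pₓᵧ / √qᵧ` of a reversible transition matrix. -/
def symmetrization {ι : Type*} (q : ι → ℝ) (P : Matrix ι ι ℝ) : Matrix ι ι ℝ :=
  fun x y => √(q x) * P x y / √(q y)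

namespace IsReversibleFor

variable {ι : Type*} [Fintype ι] {q : ι → ℝ} {P : Matrix ι ι ℝ}

theorem isHermitian_symmetrization (h : IsReversibleFor q P) :
    (symmetrization q P).IsHermitian := by
  ext x y
  have hx := Real.sqrt_pos.2 (h.pos x)
  have hy := Real.sqrt_pos.2 (h.pos y)
  simp only [Matrix.conjTranspose_apply, star_trivial, symmetrization]
  rw [div_eq_div_iff hx.ne' hy.ne']
  have := h.balance x y
  rw [← Real.mul_self_sqrt (h.pos x).le, ← Real.mul_self_sqrt (h.pos y).le] at this
  linarith

/-- The two matrices are similar through the diagonal matrix `√q`. This turns the roots in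
`nthEigenvalue` into eigenvalues of a symmetric matrix. -/
theorem charpoly_symmetrization [DecidableEq ι] (h : IsReversibleFor q P) :
    (symmetrization q P).charpoly = P.charpoly := by
  have h1 : symmetrization q P =
      Matrix.diagonal (fun x => √(q x)) * (P * Matrix.diagonal (fun x => (√(q x))⁻¹)) := by
    ext x y
    rw [Matrix.diagonal_mul, Matrix.mul_diagonal, symmetrization, div_eq_mul_inv, mul_assoc]
  rw [h1, Matrix.charpoly_mul_comm, Matrix.mul_assoc, Matrix.diagonal_mul_diagonal]
  have : (fun x => (√(q x))⁻¹ * √(q x)) = fun _ => 1 := by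
    ext x
    exact inv_mul_cancel₀ (Real.sqrt_pos.2 (h.pos x)).ne'
  rw [this, Matrix.diagonal_one, Matrix.mul_one]

/-- The map `g ↦ √q g` is an isometry from `L²(q)` to Euclidean space and intertwines `P` with its
symmetrization. -/
theorem symmetrization_mulVec (h : IsReversibleFor q P) (g : ι → ℝ) :
    (symmetrization q P).mulVec (fun x => √(q x) * g x) = fun x => √(q x) * P.mulVec g x := by
  ext x
  simp only [Matrix.mulVec, dotProduct, symmetrization, Finset.mul_sum]
  refine Finset.sum_congr rfl fun y _ => ?_
  have := (Real.sqrt_pos.2 (h.pos y)).ne'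
  field_simp

theorem mulVec_one (h : IsReversibleFor q P) : P.mulVec (fun _ => 1) = fun _ => 1 := by
  ext x
  simpa [Matrix.mulVec, dotProduct] using h.sum_row x

theorem sum_mul_mulVec (h : IsReversibleFor q P) (g : ι → ℝ) :
    ∑ x, q x * P.mulVec g x = ∑ x, q x * g x := by
  simp only [Matrix.mulVec, dotProduct, Finset.mul_sum]
  rw [Finset.sum_comm]
  refine Finset.sum_congr rfl fun y _ => ?_
  have : ∀ x, q x * (P x y * g y) = q y * g y * P y x := fun x => by
    rw [← mul_assoc, h.balance]; ring
  simp only [this, ← Finset.mul_sum, h.sum_row, mul_one]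

end IsReversibleFor

/-- With `i₀` the index of the largest eigenvalue, all others lie between the smallest and the
second largest. The factor `2` undoes the `1/2` in the definition of the gap. For `n = 0` there is
no other index. -/
theorem abs_eigenvalue_le_of_le_spectralGap {n : ℕ} {q : Cube n → ℝ}
    {P : Matrix (Cube n) (Cube n) ℝ} (h : IsReversibleFor q P) {γ : ℝ} (hg : γ ≤ spectralGap P) :
    ∃ i₀, ∀ i, i ≠ i₀ → |h.isHermitian_symmetrization.eigenvalues i| ≤ 1 - 2 * γ := by
  set hA := h.isHermitian_symmetrization
  have hsort : P.charpoly.roots.sort (fun a b => b ≤ a) = List.ofFn hA.eigenvalues₀ := by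
    rw [← hA.sort_roots_charpoly_eq_eigenvalues₀, h.charpoly_symmetrization]
    simp
  have hcard : Fintype.card (Cube n) = 2 ^ n := by simp
  have hcard0 : 0 < Fintype.card (Cube n) := by rw [hcard]; positivity
  -- `nthEigenvalue` counts from one, `eigenvalues₀` from zero.
  have key : ∀ j : ℕ, ∀ hj : j < Fintype.card (Cube n),
      nthEigenvalue P (j + 1) = hA.eigenvalues₀ ⟨j, hj⟩ := by
    intro j hj
    rw [nthEigenvalue, hsort, List.getD_eq_getElem _ _ (by simpa using hj)]
    simp
  refine ⟨Fintype.equivOfCardEq (Fintype.card_fin _) ⟨0, hcard0⟩, fun i hi => ?_⟩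
  rw [Matrix.IsHermitian.eigenvalues]
  set j := (Fintype.equivOfCardEq (Fintype.card_fin (Fintype.card (Cube n)))).symm i with hj
  have hj0 : j ≠ ⟨0, hcard0⟩ := fun h0 => hi (by rw [← h0, hj, Equiv.apply_symm_apply])
  have hj1 : 1 ≤ (j : ℕ) := Nat.one_le_iff_ne_zero.2 fun h0 => hj0 (Fin.ext h0)
  have h2 : 1 < Fintype.card (Cube n) := hj1.trans_lt j.2
  have hup : hA.eigenvalues₀ j ≤ nthEigenvalue P 2 := by
    rw [key 1 h2]
    exact hA.eigenvalues₀_antitone hj1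
  have hlo : nthEigenvalue P (2 ^ n) ≤ hA.eigenvalues₀ j := by
    have := key (2 ^ n - 1) (by omega)
    rw [Nat.sub_add_cancel (by omega)] at this
    rw [this]
    exact hA.eigenvalues₀_antitone (by
      rw [Fin.le_def]
      have := j.2
      simp only
      omega)
  unfold spectralGap at hg
  have m1 := le_max_left |nthEigenvalue P 2| |nthEigenvalue P (2 ^ n)|
  have m2 := le_max_right |nthEigenvalue P 2| |nthEigenvalue P (2 ^ n)|
  have a1 := le_abs_self (nthEigenvalue P 2)
  have a2 := neg_abs_le (nthEigenvalue P (2 ^ n))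
  rw [abs_le]
  constructor <;> linarith

/-- It makes the contraction factor `1 - 2γ` nonnegative. -/
theorem spectralGap_le_half {n : ℕ} (P : Matrix (Cube n) (Cube n) ℝ) : spectralGap P ≤ 1 / 2 := by
  have := (abs_nonneg (nthEigenvalue P 2)).trans (le_max_left _ |nthEigenvalue P (2 ^ n)|)
  unfold spectralGap
  linarith

/-! ### Geometric ergodicity. -/

namespace IsReversibleFor

variable {n : ℕ} {q : Cube n → ℝ} {P : Matrix (Cube n) (Cube n) ℝ}

/-- A reversible chain contracts centred functions in `L²(q)`. -/
theorem sum_mul_mulVec_sq_le (h : IsReversibleFor q P) {γ : ℝ} (hγ : 0 < γ)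
    (hg : γ ≤ spectralGap P) {g : Cube n → ℝ} (h0 : ∑ x, q x * g x = 0) :
    ∑ x, q x * P.mulVec g x ^ 2 ≤ (1 - 2 * γ) ^ 2 * ∑ x, q x * g x ^ 2 := by
  obtain ⟨i₀, hi₀⟩ := abs_eigenvalue_le_of_le_spectralGap h hg
  have hsq : ∀ (g : Cube n → ℝ) x, √(q x) * g x * (√(q x) * g x) = q x * g x ^ 2 := by
    intro g x
    rw [mul_mul_mul_comm, Real.mul_self_sqrt (h.pos x).le, pow_two]
  -- The constant function `1`, fixed by `P`, corresponds to `√q`; orthogonality to it is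
  -- centredness under `q`.
  have hw : (fun x => √(q x) * (1 : ℝ)) ≠ 0 := fun h1 => by
    have := congrFun h1 1
    simp only [mul_one, Pi.zero_apply] at this
    exact (Real.sqrt_pos.2 (h.pos 1)).ne' this
  have := h.isHermitian_symmetrization.mulVec_dotProduct_self_le (by linarith) hi₀ hw
    (by rw [h.symmetrization_mulVec, h.mulVec_one]) (v := fun x => √(q x) * g x) (by
      rw [← h0]
      refine Finset.sum_congr rfl fun x _ => ?_
      beta_reduce
      rw [← mul_assoc, mul_one, Real.mul_self_sqrt (h.pos x).le])
  rw [h.symmetrization_mulVec] at this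
  simpa only [dotProduct, hsq] using this

/-- Geometric ergodicity: the iterates of a bounded centred function decay uniformly. -/
theorem abs_pow_mulVec_le (h : IsReversibleFor q P) {γ : ℝ} (hγ : 0 < γ)
    (hg : γ ≤ spectralGap P) {M : ℝ} (hM : 0 ≤ M) (hq : ∀ x, Real.exp (-M) ≤ q x)
    {g : Cube n → ℝ} (h0 : ∑ x, q x * g x = 0) {R : ℝ} (hR : ∀ x, |g x| ≤ R) (t : ℕ)
    (x : Cube n) : |(P ^ t).mulVec g x| ≤ Real.exp M * R * (1 - 2 * γ) ^ t := by
  have hγ1 := hg.trans (spectralGap_le_half P)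
  have hR0 : 0 ≤ R := (abs_nonneg _).trans (hR x)
  have step : ∀ t : ℕ, ∑ x, q x * (P ^ t).mulVec g x = 0 ∧
      ∑ x, q x * (P ^ t).mulVec g x ^ 2 ≤ ((1 - 2 * γ) ^ t) ^ 2 * R ^ 2 := by
    intro t
    induction t with
    | zero =>
      simp only [pow_zero, Matrix.one_mulVec, one_pow, one_mul]
      refine ⟨h0, ?_⟩
      calc ∑ x, q x * g x ^ 2 ≤ ∑ x, q x * R ^ 2 := Finset.sum_le_sum fun x _ =>
            mul_le_mul_of_nonneg_left (by rw [← sq_abs]; gcongr; exact hR x) (h.pos x).le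
        _ = R ^ 2 := by rw [← Finset.sum_mul, h.sum_target, one_mul]
    | succ t ih =>
      rw [pow_succ', ← Matrix.mulVec_mulVec]
      refine ⟨by rw [h.sum_mul_mulVec, ih.1], (h.sum_mul_mulVec_sq_le hγ hg ih.1).trans ?_⟩
      calc _ ≤ (1 - 2 * γ) ^ 2 * (((1 - 2 * γ) ^ t) ^ 2 * R ^ 2) :=
            mul_le_mul_of_nonneg_left ih.2 (sq_nonneg _)
        _ = _ := by ring
  -- A single term of the `L²(q)` norm controls the value at `x`, at the cost of dividing by `q x ≥
  -- exp (-M)`.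
  have h1 : q x * (P ^ t).mulVec g x ^ 2 ≤ ((1 - 2 * γ) ^ t) ^ 2 * R ^ 2 :=
    (Finset.single_le_sum (f := fun x => q x * (P ^ t).mulVec g x ^ 2)
      (fun y _ => mul_nonneg (h.pos y).le (sq_nonneg _)) (Finset.mem_univ x)).trans (step t).2
  have h2 : Real.exp (-M) * (P ^ t).mulVec g x ^ 2 ≤ ((1 - 2 * γ) ^ t) ^ 2 * R ^ 2 :=
    (mul_le_mul_of_nonneg_right (hq x) (sq_nonneg _)).trans h1
  have h3 : (P ^ t).mulVec g x ^ 2 ≤ Real.exp M * (((1 - 2 * γ) ^ t) ^ 2 * R ^ 2) := by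
    have := mul_le_mul_of_nonneg_left h2 (Real.exp_pos M).le
    rwa [← mul_assoc, ← Real.exp_add, add_neg_cancel, Real.exp_zero, one_mul] at this
  have hr : 0 ≤ (1 - 2 * γ) ^ t := pow_nonneg (by linarith) t
  refine abs_le_of_sq_le_sq (h3.trans ?_) (by positivity)
  -- The factor `exp M` is enlarged to `exp M ^ 2`, so that the bound is a perfect square.
  have he : 1 ≤ Real.exp M := Real.one_le_exp hM
  calc Real.exp M * (((1 - 2 * γ) ^ t) ^ 2 * R ^ 2)
      ≤ Real.exp M * Real.exp M * (((1 - 2 * γ) ^ t) ^ 2 * R ^ 2) := by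
        refine mul_le_mul_of_nonneg_right ?_ (by positivity)
        exact le_mul_of_one_le_left (Real.exp_pos M).le he
    _ = _ := by ring

theorem abs_pow_mulVec_le_of_abs_le (h : IsReversibleFor q P) {g : Cube n → ℝ} {R : ℝ}
    (hR : ∀ x, |g x| ≤ R) (t : ℕ) (x : Cube n) : |(P ^ t).mulVec g x| ≤ R := by
  induction t generalizing x with
  | zero => simpa using hR x
  | succ t ih =>
    rw [pow_succ', ← Matrix.mulVec_mulVec]
    calc |P.mulVec ((P ^ t).mulVec g) x| ≤ ∑ y, |P x y * (P ^ t).mulVec g y| :=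
          Finset.abs_sum_le_sum_abs _ _
      _ ≤ ∑ y, P x y * R := Finset.sum_le_sum fun y _ => by
          rw [abs_mul, abs_of_nonneg (h.nonneg x y)]
          exact mul_le_mul_of_nonneg_left (ih y) (h.nonneg x y)
      _ = R := by rw [← Finset.sum_mul, h.sum_row, one_mul]

end IsReversibleFor

/-! ### Expectations over the paths of one chain. -/

section PathExpectation

variable {n : ℕ} {P : Matrix (Cube n) (Cube n) ℝ}

/-- The expectation of a function of the first `N` states of a Markov chain. -/
def pathExp (P : Matrix (Cube n) (Cube n) ℝ) (x : Cube n) (N : ℕ)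
    (Φ : (Fin N → Cube n) → ℝ) : ℝ :=
  ∑ y, pathProb P x N y * Φ y

theorem pathProb_nonneg (hP : ∀ x y, 0 ≤ P x y) (x : Cube n) (N : ℕ) (y : Fin N → Cube n) :
    0 ≤ pathProb P x N y := by
  cases N with
  | zero => exact zero_le_one
  | succ N =>
    refine mul_nonneg ?_ (Finset.prod_nonneg fun v _ => hP _ _)
    split_ifs <;> norm_num

/-- The Markov property at the first step. `pathProb` forces the starting state, so only `z = y 0`
contributes to the sum. -/
theorem pathProb_cons (x a : Cube n) (N : ℕ) (y : Fin (N + 1) → Cube n) :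
    pathProb P x (N + 2) (Fin.cons a y : Fin (N + 2) → Cube n) =
      (if a = x then 1 else 0) * ∑ z, P x z * pathProb P z (N + 1) y := by
  simp only [pathProb, Fin.cons_zero]
  by_cases h : a = x
  · subst h
    rw [Fin.prod_univ_succ, Finset.sum_eq_single (y 0)]
    · simp [Fin.castSucc_succ]
    · intro z _ hz
      simp [hz.symm]
    · simp
  · simp [h]

theorem pathExp_succ (x : Cube n) (N : ℕ) (Φ : (Fin (N + 2) → Cube n) → ℝ) :
    pathExp P x (N + 2) Φ =
      ∑ z, P x z * pathExp P z (N + 1) (fun y => Φ (Fin.cons x y : Fin (N + 2) → Cube n)) := by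
  unfold pathExp
  rw [← (Fin.consEquiv (fun _ : Fin (N + 2) => Cube n)).sum_comp, Fintype.sum_prod_type]
  change ∑ a : Cube n, ∑ y : Fin (N + 1) → Cube n,
    pathProb P x (N + 2) (Fin.cons a y : Fin (N + 2) → Cube n) *
      Φ (Fin.cons a y : Fin (N + 2) → Cube n) = _
  simp only [pathProb_cons]
  rw [Finset.sum_eq_single x]
  · simp only [if_true, one_mul, Finset.mul_sum, Finset.sum_mul]
    rw [Finset.sum_comm]
    simp only [mul_assoc]
  · intro a _ ha
    simp [ha]
  · simp

theorem pathExp_one (hP : ∀ x, ∑ y, P x y = 1) (x : Cube n) (N : ℕ) :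
    pathExp P x N (fun _ => 1) = 1 := by
  rcases N with _ | N
  · simp [pathExp, pathProb]
  induction N generalizing x with
  | zero =>
    unfold pathExp
    rw [← (Equiv.funUnique (Fin 1) (Cube n)).symm.sum_comp]
    simp [pathProb]
  | succ N ih => simp [pathExp_succ, ih, hP]

theorem pathExp_head_mul (x : Cube n) (N : ℕ) (φ : Cube n → ℝ)
    (Φ : (Fin (N + 1) → Cube n) → ℝ) :
    pathExp P x (N + 1) (fun y => φ (y 0) * Φ y) = φ x * pathExp P x (N + 1) Φ := by
  unfold pathExp
  rw [Finset.mul_sum]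
  refine Finset.sum_congr rfl fun y _ => ?_
  by_cases h : y 0 = x
  · simp only [h]; ring
  · simp [pathProb, h]

theorem pathExp_apply (hP : ∀ x, ∑ y, P x y = 1) (ψ : Cube n → ℝ) {N : ℕ} (j : Fin N)
    (x : Cube n) : pathExp P x N (fun y => ψ (y j)) = (P ^ (j : ℕ)).mulVec ψ x := by
  rcases N with _ | N
  · exact j.elim0
  induction N generalizing x with
  | zero =>
    have := pathExp_head_mul (P := P) x 0 ψ (fun _ => 1)
    rw [Fin.fin_one_eq_zero j]
    simpa [pathExp_one hP] using this
  | succ N ih =>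
    refine Fin.cases ?_ (fun l => ?_) j
    · have := pathExp_head_mul (P := P) x (N + 1) ψ (fun _ => 1)
      simpa [pathExp_one hP] using this
    · rw [pathExp_succ, Fin.val_succ, pow_succ', ← Matrix.mulVec_mulVec]
      simp only [Fin.cons_succ, ih]
      rfl

/-- The Markov property at time `i`: leading states are stripped off until the earlier index is the
head of the path, where `φ` factors out and only the one-time formula is needed. -/
theorem pathExp_apply_mul_apply (hP : ∀ x, ∑ y, P x y = 1) (φ ψ : Cube n → ℝ) {N : ℕ}
    {i j : Fin N} (hij : i ≤ j) (x : Cube n) :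
    pathExp P x N (fun y => φ (y i) * ψ (y j)) =
      (P ^ (i : ℕ)).mulVec (fun z => φ z * (P ^ ((j : ℕ) - i)).mulVec ψ z) x := by
  rcases N with _ | N
  · exact j.elim0
  induction N generalizing x with
  | zero =>
    rw [Fin.fin_one_eq_zero i, pathExp_head_mul, pathExp_apply hP]
    simp
  | succ N ih =>
    revert hij
    refine Fin.cases (fun _ => ?_) (fun k => ?_) i
    · rw [pathExp_head_mul, pathExp_apply hP]
      simp
    · refine Fin.cases (fun h => absurd h (by simp)) (fun l h => ?_) j
      rw [pathExp_succ]
      simp only [Fin.cons_succ, Fin.val_succ, ih _ (Fin.succ_le_succ_iff.1 h), pow_succ',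
        Nat.add_sub_add_right]
      rw [← Matrix.mulVec_mulVec]
      rfl

end PathExpectation

/-! ### Bias and mean squared error of time averages along one chain. -/

theorem sum_geometric_le {r : ℝ} (h0 : 0 ≤ r) (h1 : r < 1) (m : ℕ) :
    ∑ j ∈ Finset.range m, r ^ j ≤ 1 / (1 - r) := by
  rw [one_div, ← tsum_geometric_of_lt_one h0 h1]
  exact (summable_geometric_of_lt_one h0 h1).sum_le_tsum _ fun i _ => pow_nonneg h0 i

/-- With truncated subtraction the exponent is `|j - i|`. Splitting after `i` leaves two sums
bounded by geometric series. -/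
theorem sum_pow_natDist_le {r : ℝ} (h0 : 0 ≤ r) (h1 : r < 1) {m : ℕ} (i : Fin m) :
    ∑ j : Fin m, r ^ (((j : ℕ) - i) + ((i : ℕ) - j)) ≤ 2 / (1 - r) := by
  rw [Fin.sum_univ_eq_sum_range (fun j => r ^ ((j - (i : ℕ)) + ((i : ℕ) - j))) m,
    ← Finset.sum_range_add_sum_Ico _ (Nat.succ_le_of_lt i.2), Finset.sum_Ico_eq_sum_range,
    ← Finset.sum_range_reflect]
  have e1 : ∑ j ∈ Finset.range (i + 1),
      r ^ (((i : ℕ) + 1 - 1 - j - i) + ((i : ℕ) - ((i : ℕ) + 1 - 1 - j))) =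
      ∑ j ∈ Finset.range (i + 1), r ^ j :=
    Finset.sum_congr rfl fun j hj => by
      have := Finset.mem_range.1 hj
      congr 1
      omega
  have e2 : ∑ j ∈ Finset.range (m - (i + 1)),
      r ^ (((i : ℕ) + 1 + j - i) + ((i : ℕ) - (i + 1 + j))) ≤
      ∑ j ∈ Finset.range (m - (i + 1)), r ^ j :=
    Finset.sum_le_sum fun j _ => pow_le_pow_of_le_one h0 h1.le (by omega)
  simp only [Nat.succ_eq_add_one]
  rw [e1]
  have := sum_geometric_le h0 h1 (i + 1)
  have := sum_geometric_le h0 h1 (m - (i + 1))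
  have e3 : 2 / (1 - r) = 1 / (1 - r) + 1 / (1 - r) := by ring
  linarith

namespace IsReversibleFor

variable {n : ℕ} {q : Cube n → ℝ} {P : Matrix (Cube n) (Cube n) ℝ}

/-- Bias of a time average along one chain. -/
theorem abs_pathExp_avg_le (h : IsReversibleFor q P) {γ : ℝ} (hγ : 0 < γ)
    (hg : γ ≤ spectralGap P) {M : ℝ} (hM : 0 ≤ M) (hq : ∀ x, Real.exp (-M) ≤ q x)
    {φ : Cube n → ℝ} (h0 : ∑ x, q x * φ x = 0) {R : ℝ} (hR : ∀ x, |φ x| ≤ R) (b m : ℕ)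
    (x : Cube n) :
    |pathExp P x (b + m) (fun y => (1 / (m : ℝ)) * ∑ j : Fin m, φ (y (Fin.natAdd b j)))| ≤
      Real.exp M / γ * R / m := by
  have hγ1 := hg.trans (spectralGap_le_half P)
  have hR0 : 0 ≤ R := (abs_nonneg _).trans (hR x)
  have e : pathExp P x (b + m) (fun y => (1 / (m : ℝ)) * ∑ j : Fin m, φ (y (Fin.natAdd b j))) =
      (1 / (m : ℝ)) * ∑ j : Fin m, (P ^ (b + (j : ℕ))).mulVec φ x := by
    have e1 : ∀ j : Fin m, (P ^ (b + (j : ℕ))).mulVec φ x =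
        pathExp P x (b + m) (fun y => φ (y (Fin.natAdd b j))) := fun j => by
      rw [pathExp_apply h.sum_row φ (Fin.natAdd b j) x]; rfl
    simp only [e1, pathExp, Finset.mul_sum]
    rw [Finset.sum_comm]
    exact Finset.sum_congr rfl fun j _ => Finset.sum_congr rfl fun y _ => by ring
  -- The warm-up can only improve the decay, so its factor `(1 - 2γ) ^ b` is bounded by `1`.
  have hb : ∑ j : Fin m, |(P ^ (b + (j : ℕ))).mulVec φ x| ≤ Real.exp M * R * (1 / γ) := by
    calc _ ≤ ∑ j : Fin m, Real.exp M * R * (1 - 2 * γ) ^ (j : ℕ) :=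
          Finset.sum_le_sum fun j _ => (h.abs_pow_mulVec_le hγ hg hM hq h0 hR _ x).trans
            (mul_le_mul_of_nonneg_left (pow_le_pow_of_le_one (by linarith) (by linarith)
              (Nat.le_add_left _ _)) (by positivity))
      _ = Real.exp M * R * ∑ j ∈ Finset.range m, (1 - 2 * γ) ^ j := by
          rw [← Finset.mul_sum, Fin.sum_univ_eq_sum_range]
      _ ≤ Real.exp M * R * (1 / (1 - (1 - 2 * γ))) :=
          mul_le_mul_of_nonneg_left (sum_geometric_le (by linarith) (by linarith) m)
            (by positivity)
      _ ≤ _ := mul_le_mul_of_nonneg_left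
            (one_div_le_one_div_of_le hγ (by linarith)) (by positivity)
  rw [e, abs_mul, abs_of_nonneg (by positivity : (0 : ℝ) ≤ 1 / m)]
  calc _ ≤ (1 / (m : ℝ)) * (Real.exp M * R * (1 / γ)) :=
        mul_le_mul_of_nonneg_left ((Finset.abs_sum_le_sum_abs _ _).trans hb) (by positivity)
    _ = _ := by ring

/-- Mean squared error of a time average along one chain. -/
theorem pathExp_avg_sq_le (h : IsReversibleFor q P) {γ : ℝ} (hγ : 0 < γ)
    (hg : γ ≤ spectralGap P) {M : ℝ} (hM : 0 ≤ M) (hq : ∀ x, Real.exp (-M) ≤ q x)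
    {φ : Cube n → ℝ} (h0 : ∑ x, q x * φ x = 0) {R : ℝ} (hR : ∀ x, |φ x| ≤ R) (b : ℕ) {m : ℕ}
    (hm : 1 ≤ m) (x : Cube n) :
    pathExp P x (b + m) (fun y => ((1 / (m : ℝ)) * ∑ j : Fin m, φ (y (Fin.natAdd b j))) ^ 2) ≤
      Real.exp M / γ * R ^ 2 / m := by
  have hγ1 := hg.trans (spectralGap_le_half P)
  have hR0 : 0 ≤ R := (abs_nonneg _).trans (hR x)
  have hm0 : (0 : ℝ) < m := by exact_mod_cast hm
  have e : pathExp P x (b + m)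
      (fun y => ((1 / (m : ℝ)) * ∑ j : Fin m, φ (y (Fin.natAdd b j))) ^ 2) =
      (1 / (m : ℝ)) ^ 2 * ∑ i : Fin m, ∑ j : Fin m,
        pathExp P x (b + m) (fun y => φ (y (Fin.natAdd b i)) * φ (y (Fin.natAdd b j))) := by
    simp only [pathExp, Finset.mul_sum, pow_two (∑ j : Fin m, _), Finset.sum_mul]
    rw [Finset.sum_comm]
    refine Finset.sum_congr rfl fun i _ => ?_
    rw [Finset.sum_comm]
    exact Finset.sum_congr rfl fun j _ => Finset.sum_congr rfl fun y _ => by ring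
  -- Decay is used only across the time lag `j - i`; the evolution up to the earlier time is bounded
  -- in sup norm, so the chain need not be stationary.
  have aux : ∀ i j : Fin m, i ≤ j →
      pathExp P x (b + m) (fun y => φ (y (Fin.natAdd b i)) * φ (y (Fin.natAdd b j))) ≤
        Real.exp M * R ^ 2 * (1 - 2 * γ) ^ ((j : ℕ) - i) := by
    intro i j hij
    rw [pathExp_apply_mul_apply h.sum_row φ φ
      (i := Fin.natAdd b i) (j := Fin.natAdd b j) (Fin.le_def.2 (Nat.add_le_add_left (Fin.le_def.1 hij) b))]
    refine (le_abs_self _).trans (h.abs_pow_mulVec_le_of_abs_le (fun z => ?_) _ x)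
    have : ((Fin.natAdd b j : Fin (b + m)) : ℕ) - (Fin.natAdd b i : Fin (b + m)) =
        (j : ℕ) - i := by simp only [Fin.val_natAdd]; omega
    rw [this, abs_mul]
    calc |φ z| * |(P ^ ((j : ℕ) - i)).mulVec φ z|
        ≤ R * (Real.exp M * R * (1 - 2 * γ) ^ ((j : ℕ) - i)) :=
          mul_le_mul (hR z) (h.abs_pow_mulVec_le hγ hg hM hq h0 hR _ z) (abs_nonneg _) hR0
      _ = _ := by ring
  have aux2 : ∀ i j : Fin m,
      pathExp P x (b + m) (fun y => φ (y (Fin.natAdd b i)) * φ (y (Fin.natAdd b j))) ≤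
        Real.exp M * R ^ 2 * (1 - 2 * γ) ^ (((j : ℕ) - i) + ((i : ℕ) - j)) := by
    intro i j
    rcases le_total i j with hij | hij
    · rw [Nat.sub_eq_zero_of_le (Fin.le_def.1 hij), add_zero]
      exact aux i j hij
    · rw [Nat.sub_eq_zero_of_le (Fin.le_def.1 hij), zero_add]
      refine (le_of_eq ?_).trans (aux j i hij)
      congr 1
      funext y
      exact mul_comm _ _
  rw [e]
  calc _ ≤ (1 / (m : ℝ)) ^ 2 * ∑ i : Fin m, ∑ j : Fin m,
          Real.exp M * R ^ 2 * (1 - 2 * γ) ^ (((j : ℕ) - i) + ((i : ℕ) - j)) :=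
        mul_le_mul_of_nonneg_left (Finset.sum_le_sum fun i _ => Finset.sum_le_sum fun j _ =>
          aux2 i j) (by positivity)
    _ ≤ (1 / (m : ℝ)) ^ 2 * ∑ i : Fin m, Real.exp M * R ^ 2 * (1 / γ) := by
        refine mul_le_mul_of_nonneg_left (Finset.sum_le_sum fun i _ => ?_) (by positivity)
        rw [← Finset.mul_sum]
        refine mul_le_mul_of_nonneg_left
          ((sum_pow_natDist_le (by linarith) (by linarith) i).trans (le_of_eq ?_)) (by positivity)
        field_simp
        ring
    _ = _ := by
        simp only [Finset.sum_const, Finset.card_univ, Fintype.card_fin, nsmul_eq_mul]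
        field_simp

end IsReversibleFor

/-! ### Averages over independent chains. -/

section IndependentAverage

variable {k : ℕ} {α : Type*} [Fintype α] {w : Fin k → α → ℝ}

theorem sum_prod_weight_mul_prod (w c : Fin k → α → ℝ) :
    ∑ y : Fin k → α, (∏ i, w i (y i)) * ∏ i, c i (y i) = ∏ i, ∑ z, w i z * c i z := by
  rw [Finset.prod_univ_sum, Fintype.piFinset_univ]
  simp only [Finset.prod_mul_distrib]

theorem sum_prod_weight (hw : ∀ i, ∑ z, w i z = 1) :
    ∑ y : Fin k → α, ∏ i, w i (y i) = 1 := by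
  simpa [hw] using sum_prod_weight_mul_prod w (fun _ _ => 1)

theorem sum_prod_weight_mul_apply (hw : ∀ i, ∑ z, w i z = 1) (a : α → ℝ) (i : Fin k) :
    ∑ y : Fin k → α, (∏ l, w l (y l)) * a (y i) = ∑ z, w i z * a z := by
  -- Every factor except the `i`-th is `1` and integrates to one.
  have h := sum_prod_weight_mul_prod w (fun l z => if l = i then a z else 1)
  simp only [Finset.prod_ite_eq', Finset.mem_univ, if_true] at h
  rw [h, Finset.prod_eq_single i]
  · simp
  · intro l _ hl
    simp [hl, hw]
  · simp

theorem sum_prod_weight_mul_apply_mul_apply (hw : ∀ i, ∑ z, w i z = 1) (a c : α → ℝ)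
    {i j : Fin k} (hij : i ≠ j) :
    ∑ y : Fin k → α, (∏ l, w l (y l)) * (a (y i) * c (y j)) =
      (∑ z, w i z * a z) * ∑ z, w j z * c z := by
  have h := sum_prod_weight_mul_prod w
    (fun l z => (if l = i then a z else 1) * (if l = j then c z else 1))
  simp only [Finset.prod_mul_distrib, Finset.prod_ite_eq', Finset.mem_univ, if_true] at h
  rw [h, Finset.prod_eq_mul i j hij]
  · simp [hij, hij.symm]
  · intro l _ hl
    simp [hl.1, hl.2, hw]
  · simp
  · simp

theorem abs_sum_prod_weight_mul_avg_le (hw : ∀ i, ∑ z, w i z = 1) (hk : 1 ≤ k) (a : α → ℝ)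
    {β : ℝ} (hβ : ∀ i, |∑ z, w i z * a z| ≤ β) :
    |∑ y : Fin k → α, (∏ l, w l (y l)) * ((1 / (k : ℝ)) * ∑ i, a (y i))| ≤ β := by
  have hk0 : (0 : ℝ) < k := by exact_mod_cast hk
  have e : ∑ y : Fin k → α, (∏ l, w l (y l)) * ((1 / (k : ℝ)) * ∑ i, a (y i)) =
      (1 / (k : ℝ)) * ∑ i, ∑ z, w i z * a z := by
    simp only [← sum_prod_weight_mul_apply hw, Finset.mul_sum]
    rw [Finset.sum_comm]
    exact Finset.sum_congr rfl fun i _ => Finset.sum_congr rfl fun y _ => by ring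
  rw [e, abs_mul, abs_of_pos (by positivity : 0 < 1 / (k : ℝ))]
  calc _ ≤ (1 / (k : ℝ)) * ∑ _i : Fin k, β := mul_le_mul_of_nonneg_left
        ((Finset.abs_sum_le_sum_abs _ _).trans (Finset.sum_le_sum fun i _ => hβ i)) (by positivity)
    _ = β := by simp [hk0.ne']

/-- Expanding the square gives `k` diagonal terms of size at most `V` and off-diagonal terms that
factor by independence into products of means, each at most `β ^ 2`. -/
theorem sum_prod_weight_mul_avg_sq_le (hw : ∀ i, ∑ z, w i z = 1) (hk : 1 ≤ k) (a : α → ℝ)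
    {β V : ℝ} (hβ : ∀ i, |∑ z, w i z * a z| ≤ β) (hV : ∀ i, ∑ z, w i z * a z ^ 2 ≤ V) :
    ∑ y : Fin k → α, (∏ l, w l (y l)) * ((1 / (k : ℝ)) * ∑ i, a (y i)) ^ 2 ≤
      V / k + β ^ 2 := by
  have hk0 : (0 : ℝ) < k := by exact_mod_cast hk
  have e : ∑ y : Fin k → α, (∏ l, w l (y l)) * ((1 / (k : ℝ)) * ∑ i, a (y i)) ^ 2 =
      (1 / (k : ℝ)) ^ 2 * ∑ i, ∑ j, ∑ y : Fin k → α, (∏ l, w l (y l)) * (a (y i) * a (y j)) := by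
    simp only [pow_two (∑ i : Fin k, _), Finset.mul_sum, Finset.sum_mul]
    rw [Finset.sum_comm]
    refine Finset.sum_congr rfl fun i _ => ?_
    rw [Finset.sum_comm]
    exact Finset.sum_congr rfl fun j _ => Finset.sum_congr rfl fun y _ => by ring
  have aux : ∀ i j, ∑ y : Fin k → α, (∏ l, w l (y l)) * (a (y i) * a (y j)) ≤
      (if i = j then V else 0) + β ^ 2 := by
    intro i j
    by_cases h : i = j
    · subst h
      rw [if_pos rfl, sum_prod_weight_mul_apply hw (fun z => a z * a z) i]
      simp only [← pow_two]
      exact (hV i).trans (le_add_of_nonneg_right (sq_nonneg _))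
    · rw [if_neg h, sum_prod_weight_mul_apply_mul_apply hw a a h, zero_add]
      refine (le_abs_self _).trans ?_
      rw [abs_mul, pow_two]
      exact mul_le_mul (hβ i) (hβ j) (abs_nonneg _) ((abs_nonneg _).trans (hβ i))
  rw [e]
  calc _ ≤ (1 / (k : ℝ)) ^ 2 * ∑ i : Fin k, ∑ j : Fin k, ((if i = j then V else 0) + β ^ 2) :=
        mul_le_mul_of_nonneg_left (Finset.sum_le_sum fun i _ => Finset.sum_le_sum fun j _ =>
          aux i j) (by positivity)
    _ = _ := by
        simp only [Finset.sum_add_distrib, Finset.sum_ite_eq, Finset.mem_univ, if_true,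
          Finset.sum_const, Finset.card_univ, Fintype.card_fin, nsmul_eq_mul]
        field_simp

end IndependentAverage

/-- The probability of an array of `k` independent paths. -/
def arrayProb {n k : ℕ} (P : Matrix (Cube n) (Cube n) ℝ) (s : Fin k → Cube n) (N : ℕ)
    (y : Fin k → Fin N → Cube n) : ℝ :=
  ∏ i, pathProb P (s i) N (y i)

/-- The average of a function over the retained states of an array of paths. -/
def retainedAvg {n k m b : ℕ} (φ : Cube n → ℝ) (y : Fin k → Fin (b + m) → Cube n) : ℝ :=
  (1 / ((k : ℝ) * m)) * ∑ i, ∑ j : Fin m, φ (y i (Fin.natAdd b j))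

theorem retainedAvg_eq {n k m b : ℕ} (φ : Cube n → ℝ) (y : Fin k → Fin (b + m) → Cube n) :
    retainedAvg φ y =
      (1 / (k : ℝ)) * ∑ i, (1 / (m : ℝ)) * ∑ j : Fin m, φ (y i (Fin.natAdd b j)) := by
  rw [retainedAvg, ← Finset.mul_sum, ← mul_assoc, one_div_mul_one_div]

theorem retainedAvg_sub_const {n k m b : ℕ} (hk : 1 ≤ k) (hm : 1 ≤ m) (φ : Cube n → ℝ) (c : ℝ)
    (y : Fin k → Fin (b + m) → Cube n) :
    retainedAvg φ y - c =
      (1 / (k : ℝ)) * ∑ i, (1 / (m : ℝ)) * ∑ j : Fin m, (φ (y i (Fin.natAdd b j)) - c) := by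
  have hk0 : (k : ℝ) ≠ 0 := by positivity
  have hm0 : (m : ℝ) ≠ 0 := by positivity
  rw [← retainedAvg_eq (fun x => φ x - c)]
  simp only [retainedAvg, Finset.sum_sub_distrib, Finset.sum_const, Finset.card_univ,
    Fintype.card_fin, nsmul_eq_mul, mul_sub]
  field_simp

theorem abs_retainedAvg_le {n k m b : ℕ} (hk : 1 ≤ k) (hm : 1 ≤ m) {φ : Cube n → ℝ} {R : ℝ}
    (hR : ∀ x, |φ x| ≤ R) (y : Fin k → Fin (b + m) → Cube n) : |retainedAvg φ y| ≤ R := by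
  have hk0 : (k : ℝ) ≠ 0 := by positivity
  have hm0 : (m : ℝ) ≠ 0 := by positivity
  rw [retainedAvg, abs_mul, abs_of_nonneg (by positivity : (0 : ℝ) ≤ 1 / (k * m))]
  calc _ ≤ (1 / ((k : ℝ) * m)) * ∑ _i : Fin k, ∑ _j : Fin m, R :=
        mul_le_mul_of_nonneg_left ((Finset.abs_sum_le_sum_abs _ _).trans
          (Finset.sum_le_sum fun i _ => (Finset.abs_sum_le_sum_abs _ _).trans
            (Finset.sum_le_sum fun j _ => hR _))) (by positivity)
    _ = R := by
        simp only [Finset.sum_const, Finset.card_univ, Fintype.card_fin, nsmul_eq_mul]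
        field_simp

theorem arrayProb_nonneg {n k : ℕ} {P : Matrix (Cube n) (Cube n) ℝ} (hP : ∀ x y, 0 ≤ P x y)
    (s : Fin k → Cube n) (N : ℕ) (y : Fin k → Fin N → Cube n) : 0 ≤ arrayProb P s N y :=
  Finset.prod_nonneg fun _ _ => pathProb_nonneg hP _ _ _

theorem sum_pathProb {n : ℕ} {P : Matrix (Cube n) (Cube n) ℝ} (hP : ∀ x, ∑ y, P x y = 1)
    (x : Cube n) (N : ℕ) : ∑ y, pathProb P x N y = 1 := by
  simpa [pathExp] using pathExp_one hP x N

theorem sum_arrayProb {n k : ℕ} {P : Matrix (Cube n) (Cube n) ℝ} (hP : ∀ x, ∑ y, P x y = 1)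
    (s : Fin k → Cube n) (N : ℕ) : ∑ y, arrayProb P s N y = 1 :=
  sum_prod_weight fun i => sum_pathProb hP (s i) N

namespace IsReversibleFor

variable {n k m b : ℕ} {q : Cube n → ℝ} {P : Matrix (Cube n) (Cube n) ℝ}

theorem sum_mul_sub_mean (h : IsReversibleFor q P) (φ : Cube n → ℝ) :
    ∑ x, q x * (φ x - ∑ z, q z * φ z) = 0 := by
  simp only [mul_sub, Finset.sum_sub_distrib, ← Finset.sum_mul, h.sum_target, one_mul, sub_self]

theorem abs_mean_le (h : IsReversibleFor q P) {φ : Cube n → ℝ} {R : ℝ} (hR : ∀ x, |φ x| ≤ R) :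
    |∑ z, q z * φ z| ≤ R := by
  calc _ ≤ ∑ z, q z * R := (Finset.abs_sum_le_sum_abs _ _).trans
        (Finset.sum_le_sum fun z _ => by
          rw [abs_mul, abs_of_pos (h.pos z)]
          exact mul_le_mul_of_nonneg_left (hR z) (h.pos z).le)
    _ = R := by rw [← Finset.sum_mul, h.sum_target, one_mul]

theorem abs_sub_mean_le (h : IsReversibleFor q P) {φ : Cube n → ℝ} {R : ℝ}
    (hR : ∀ x, |φ x| ≤ R) (x : Cube n) : |φ x - ∑ z, q z * φ z| ≤ 2 * R := by
  linarith [abs_sub (φ x) (∑ z, q z * φ z), hR x, h.abs_mean_le hR]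

/-- Bias of the average over `k` independent chains. -/
theorem abs_sum_arrayProb_mul_avg_le (h : IsReversibleFor q P) {γ : ℝ} (hγ : 0 < γ)
    (hg : γ ≤ spectralGap P) {M : ℝ} (hM : 0 ≤ M) (hq : ∀ x, Real.exp (-M) ≤ q x)
    {φ : Cube n → ℝ} {R : ℝ} (hR : ∀ x, |φ x| ≤ R) (hk : 1 ≤ k) (hm : 1 ≤ m)
    (s : Fin k → Cube n) :
    |∑ y, arrayProb P s (b + m) y * (retainedAvg φ y - ∑ z, q z * φ z)| ≤
      2 * (Real.exp M / γ) * R / m := by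
  simp only [retainedAvg_sub_const hk hm]
  refine abs_sum_prod_weight_mul_avg_le (fun i => sum_pathProb h.sum_row (s i) (b + m)) hk
    (fun z => (1 / (m : ℝ)) * ∑ j : Fin m, (φ (z (Fin.natAdd b j)) - ∑ z, q z * φ z))
    (β := 2 * (Real.exp M / γ) * R / m)
    (fun i => (h.abs_pathExp_avg_le hγ hg hM hq (h.sum_mul_sub_mean φ)
      (h.abs_sub_mean_le hR) b m (s i)).trans (le_of_eq (by ring)))

/-- Mean squared error of the average over `k` independent chains. -/
theorem sum_arrayProb_mul_avg_sq_le (h : IsReversibleFor q P) {γ : ℝ} (hγ : 0 < γ)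
    (hg : γ ≤ spectralGap P) {M : ℝ} (hM : 0 ≤ M) (hq : ∀ x, Real.exp (-M) ≤ q x)
    {φ : Cube n → ℝ} {R : ℝ} (hR : ∀ x, |φ x| ≤ R) (hk : 1 ≤ k) (hm : 1 ≤ m)
    (s : Fin k → Cube n) :
    ∑ y, arrayProb P s (b + m) y * (retainedAvg φ y - ∑ z, q z * φ z) ^ 2 ≤
      4 * (Real.exp M / γ) ^ 2 * R ^ 2 * (1 / ((m : ℝ) * k) + 1 / (m : ℝ) ^ 2) := by
  have hγ1 := hg.trans (spectralGap_le_half P)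
  -- This allows the factor `D` of the variance term to be enlarged to `D ^ 2`, so both terms share
  -- one constant.
  have hD : 1 ≤ Real.exp M / γ := by
    rw [le_div_iff₀ hγ]
    linarith [Real.one_le_exp hM]
  simp only [retainedAvg_sub_const hk hm]
  refine (sum_prod_weight_mul_avg_sq_le (fun i => sum_pathProb h.sum_row (s i) (b + m)) hk
    (fun z => (1 / (m : ℝ)) * ∑ j : Fin m, (φ (z (Fin.natAdd b j)) - ∑ z, q z * φ z))
    (fun i => h.abs_pathExp_avg_le hγ hg hM hq (h.sum_mul_sub_mean φ)
      (h.abs_sub_mean_le hR) b m (s i))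
    (fun i => h.pathExp_avg_sq_le hγ hg hM hq (h.sum_mul_sub_mean φ)
      (h.abs_sub_mean_le hR) b hm (s i))).trans ?_
  have hk0 : (0 : ℝ) < k := by exact_mod_cast hk
  have hm0 : (0 : ℝ) < m := by exact_mod_cast hm
  set D := Real.exp M / γ
  calc D * (2 * R) ^ 2 / m / k + (D * (2 * R) / m) ^ 2
      = 4 * D * R ^ 2 * (1 / (m * k)) + 4 * D ^ 2 * R ^ 2 * (1 / m ^ 2) := by
        field_simp; ring
    _ ≤ 4 * D ^ 2 * R ^ 2 * (1 / (m * k)) + 4 * D ^ 2 * R ^ 2 * (1 / m ^ 2) := by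
        gcongr
        nlinarith
    _ = _ := by ring

end IsReversibleFor

/-! ### The estimator with an empirical baseline. -/

/-- `1/(mk) + 1/m²`, the order of the mean squared error. -/
def mseRate (m k : ℕ) : ℝ := 1 / ((m : ℝ) * k) + 1 / (m : ℝ) ^ 2

theorem mseRate_le {m k : ℕ} (hm : 1 ≤ m) (hk : 1 ≤ k) : mseRate m k ≤ 2 / m := by
  have hk1 : (1 : ℝ) ≤ k := by exact_mod_cast hk
  have hm1 : (1 : ℝ) ≤ m := by exact_mod_cast hm
  have h1 : 1 / ((m : ℝ) * k) ≤ 1 / m :=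
    one_div_le_one_div_of_le (by linarith) (by nlinarith)
  have h2 : 1 / (m : ℝ) ^ 2 ≤ 1 / m :=
    one_div_le_one_div_of_le (by linarith) (by nlinarith)
  have : (2 : ℝ) / m = 1 / m + 1 / m := by ring
  unfold mseRate
  linarith

namespace IsReversibleFor

variable {n k m b : ℕ} {q : Cube n → ℝ} {P : Matrix (Cube n) (Cube n) ℝ}

/-- Bias of `avg u - avg F * avg h` as an estimator of the mean of `u`, for centred `h`. -/
theorem abs_sum_arrayProb_mul_baseline_le (h : IsReversibleFor q P) {γ : ℝ} (hγ : 0 < γ)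
    (hg : γ ≤ spectralGap P) {M : ℝ} (hM : 0 ≤ M) (hq : ∀ x, Real.exp (-M) ≤ q x)
    {u F g : Cube n → ℝ} {A B R : ℝ} (hu : ∀ x, |u x| ≤ A) (hF : ∀ x, |F x| ≤ B)
    (hR : ∀ x, |g x| ≤ R) (h0 : ∑ x, q x * g x = 0) (hk : 1 ≤ k) (hm : 1 ≤ m)
    (s : Fin k → Cube n) :
    |∑ y, arrayProb P s (b + m) y *
        (retainedAvg u y - retainedAvg F y * retainedAvg g y - ∑ z, q z * u z)| ≤
      (2 * (Real.exp M / γ) * A + 4 * (Real.exp M / γ) ^ 2 * (B ^ 2 + R ^ 2) +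
        2 * (Real.exp M / γ) * B * R) / m := by
  have bu := h.abs_sum_arrayProb_mul_avg_le (b := b) hγ hg hM hq hu hk hm s
  have bg := h.abs_sum_arrayProb_mul_avg_le (b := b) hγ hg hM hq hR hk hm s
  have sF := h.sum_arrayProb_mul_avg_sq_le (b := b) hγ hg hM hq hF hk hm s
  have sg := h.sum_arrayProb_mul_avg_sq_le (b := b) hγ hg hM hq hR hk hm s
  have mF := h.abs_mean_le hF
  rw [h0] at bg sg
  simp only [sub_zero] at bg sg
  have rate := mseRate_le hm hk
  rw [← mseRate] at sF sg
  set D := Real.exp M / γ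
  set μF := ∑ z, q z * F z
  have hB : 0 ≤ B := (abs_nonneg _).trans mF
  -- Both factors are fluctuations around their means, so `2ab ≤ a² + b²` and the mean squared
  -- errors suffice, without independence of the two averages.
  have cross : |∑ y, arrayProb P s (b + m) y * ((retainedAvg F y - μF) * retainedAvg g y)| ≤
      4 * D ^ 2 * (B ^ 2 + R ^ 2) / m := by
    calc _ ≤ ∑ y, (arrayProb P s (b + m) y * (retainedAvg F y - μF) ^ 2 +
          arrayProb P s (b + m) y * retainedAvg g y ^ 2) / 2 := by
          refine (Finset.abs_sum_le_sum_abs _ _).trans (Finset.sum_le_sum fun y _ => ?_)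
          have hW := arrayProb_nonneg h.nonneg s (b + m) y
          rw [abs_mul, abs_of_nonneg hW, ← mul_add, mul_div_assoc]
          refine mul_le_mul_of_nonneg_left ?_ hW
          rw [abs_mul]
          have := two_mul_le_add_sq |retainedAvg F y - μF| |retainedAvg g y|
          rw [sq_abs, sq_abs] at this
          linarith
      _ ≤ (4 * D ^ 2 * B ^ 2 * mseRate m k + 4 * D ^ 2 * R ^ 2 * mseRate m k) / 2 := by
          rw [← Finset.sum_div, Finset.sum_add_distrib]
          linarith
      _ = 2 * D ^ 2 * (B ^ 2 + R ^ 2) * mseRate m k := by ring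
      _ ≤ 2 * D ^ 2 * (B ^ 2 + R ^ 2) * (2 / m) :=
          mul_le_mul_of_nonneg_left rate (by positivity)
      _ = _ := by ring
  have e : ∑ y, arrayProb P s (b + m) y *
        (retainedAvg u y - retainedAvg F y * retainedAvg g y - ∑ z, q z * u z) =
      ∑ y, arrayProb P s (b + m) y * (retainedAvg u y - ∑ z, q z * u z) -
      ∑ y, arrayProb P s (b + m) y * ((retainedAvg F y - μF) * retainedAvg g y) -
      μF * ∑ y, arrayProb P s (b + m) y * retainedAvg g y := by
    rw [Finset.mul_sum, ← Finset.sum_sub_distrib, ← Finset.sum_sub_distrib]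
    exact Finset.sum_congr rfl fun y _ => by ring
  have last : |μF * ∑ y, arrayProb P s (b + m) y * retainedAvg g y| ≤ B * (2 * D * R / m) := by
    rw [abs_mul]
    exact mul_le_mul mF bg (abs_nonneg _) hB
  rw [e]
  refine (abs_sub _ _).trans ((add_le_add (abs_sub _ _) le_rfl).trans ?_)
  refine (add_le_add (add_le_add bu cross) last).trans (le_of_eq ?_)
  ring

/-- Mean squared error of `avg u - avg F * avg h` as an estimator of the mean of `u`, for
centred `h`. -/
theorem sum_arrayProb_mul_baseline_sq_le (h : IsReversibleFor q P) {γ : ℝ} (hγ : 0 < γ)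
    (hg : γ ≤ spectralGap P) {M : ℝ} (hM : 0 ≤ M) (hq : ∀ x, Real.exp (-M) ≤ q x)
    {u F g : Cube n → ℝ} {A B R : ℝ} (hu : ∀ x, |u x| ≤ A) (hF : ∀ x, |F x| ≤ B)
    (hR : ∀ x, |g x| ≤ R) (h0 : ∑ x, q x * g x = 0) (hk : 1 ≤ k) (hm : 1 ≤ m)
    (s : Fin k → Cube n) :
    ∑ y, arrayProb P s (b + m) y *
        (retainedAvg u y - retainedAvg F y * retainedAvg g y - ∑ z, q z * u z) ^ 2 ≤
      8 * (Real.exp M / γ) ^ 2 * (A ^ 2 + B ^ 2 * R ^ 2) * mseRate m k := by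
  have su := h.sum_arrayProb_mul_avg_sq_le (b := b) hγ hg hM hq hu hk hm s
  have sg := h.sum_arrayProb_mul_avg_sq_le (b := b) hγ hg hM hq hR hk hm s
  rw [h0] at sg
  simp only [sub_zero] at sg
  rw [← mseRate] at su sg
  set D := Real.exp M / γ
  calc _ ≤ ∑ y, (2 * (arrayProb P s (b + m) y * (retainedAvg u y - ∑ z, q z * u z) ^ 2) +
        2 * B ^ 2 * (arrayProb P s (b + m) y * retainedAvg g y ^ 2)) := by
        refine Finset.sum_le_sum fun y _ => ?_
        have hW := arrayProb_nonneg h.nonneg s (b + m) y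
        have hF2 : retainedAvg F y ^ 2 ≤ B ^ 2 := by
          rw [← sq_abs]; gcongr; exact abs_retainedAvg_le hk hm hF y
        -- For the squared error the crude bound `|avg F| ≤ B` is enough, because `avg g` is itself
        -- small.
        have : (retainedAvg u y - retainedAvg F y * retainedAvg g y - ∑ z, q z * u z) ^ 2 ≤
            2 * (retainedAvg u y - ∑ z, q z * u z) ^ 2 + 2 * (B ^ 2 * retainedAvg g y ^ 2) := by
          have h1 := mul_le_mul_of_nonneg_right hF2 (sq_nonneg (retainedAvg g y))
          nlinarith [sq_nonneg (retainedAvg u y - (∑ z, q z * u z) +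
            retainedAvg F y * retainedAvg g y)]
        calc _ ≤ arrayProb P s (b + m) y * (2 * (retainedAvg u y - ∑ z, q z * u z) ^ 2 +
              2 * (B ^ 2 * retainedAvg g y ^ 2)) := mul_le_mul_of_nonneg_left this hW
          _ = _ := by ring
    _ ≤ 2 * (4 * D ^ 2 * A ^ 2 * mseRate m k) + 2 * B ^ 2 * (4 * D ^ 2 * R ^ 2 * mseRate m k) := by
        rw [Finset.sum_add_distrib, ← Finset.mul_sum, ← Finset.mul_sum]
        gcongr
    _ = _ := by ring

end IsReversibleFor

/-! ### Smooth functions and one descent step. -/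

section Smooth

variable {d : ℕ}

theorem hasGradientAt_abs_sub_le {F : Param d → ℝ} {F' : Param d → Param d} {C : ℝ}
    (hF : ∀ θ, HasGradientAt F (F' θ) θ) (hC : ∀ θ, ‖F' θ‖ ≤ C) (x y : Param d) :
    |F x - F y| ≤ C * ‖x - y‖ := by
  have := convex_univ.norm_image_sub_le_of_norm_hasFDerivWithin_le (f := F)
    (fun z _ => (hF z).hasFDerivAt.hasFDerivWithinAt) (C := C)
    (fun z _ => by simpa using hC z) (Set.mem_univ y) (Set.mem_univ x)
  simpa using this

/-- The descent lemma. -/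
theorem IsSmoothWith.le_quadratic {l : ℝ} {F : Param d → ℝ} (hF : IsSmoothWith l F)
    (x v : Param d) :
    F (x + v) ≤ F x + inner ℝ (gradient F x) v + l / 2 * ‖v‖ ^ 2 := by
  -- The defect of the quadratic bound along the segment; the Lipschitz gradient makes it
  -- nonincreasing on `[0, 1]`, and its endpoints give the claim.
  set ψ : ℝ → ℝ := fun t =>
    F (x + t • v) - t * inner ℝ (gradient F x) v - l / 2 * ‖v‖ ^ 2 * t ^ 2 with hψ
  have hd : ∀ t, HasDerivAt ψ (inner ℝ (gradient F (x + t • v)) v - inner ℝ (gradient F x) v -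
      l * ‖v‖ ^ 2 * t) t := by
    intro t
    have h1 : HasDerivAt (fun t : ℝ => x + t • v) v t := by
      simpa using ((hasDerivAt_id t).smul_const v).const_add x
    have h2 := ((hF.1 (x + t • v)).hasGradientAt.hasFDerivAt).comp_hasDerivAt t h1
    simp only [InnerProductSpace.toDual_apply_apply] at h2
    convert! (h2.sub ((hasDerivAt_id t).mul_const (inner ℝ (gradient F x) v))).sub
      ((hasDerivAt_pow 2 t).const_mul (l / 2 * ‖v‖ ^ 2)) using 1
    simp
    ring
  have hanti : AntitoneOn ψ (Set.Icc 0 1) := by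
    refine antitoneOn_of_deriv_nonpos (convex_Icc 0 1)
      (fun t _ => (hd t).continuousAt.continuousWithinAt)
      (fun t _ => (hd t).differentiableAt.differentiableWithinAt) (fun t ht => ?_)
    rw [interior_Icc] at ht
    rw [(hd t).deriv, ← inner_sub_left]
    have h1 := real_inner_le_norm (gradient F (x + t • v) - gradient F x) v
    have h2 := hF.2 (x + t • v) x
    rw [add_sub_cancel_left, norm_smul, Real.norm_eq_abs, abs_of_pos ht.1] at h2
    have h3 := mul_le_mul_of_nonneg_right h2 (norm_nonneg v)
    nlinarith
  have := hanti (Set.left_mem_Icc.2 zero_le_one) (Set.right_mem_Icc.2 zero_le_one) zero_le_one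
  simp only [hψ, one_smul, one_mul, one_pow, mul_one, zero_smul, add_zero, zero_mul, sub_zero,
    ne_eq, OfNat.ofNat_ne_zero, not_false_eq_true, zero_pow, mul_zero] at this
  linarith

/-- One step of stochastic gradient descent with a biased gradient estimator. -/
theorem IsSmoothWith.sum_mul_step_le {l : ℝ} {F : Param d → ℝ}
    (hF : IsSmoothWith l F) {ι : Type*} [Fintype ι] {W : ι → ℝ} (hW : ∀ y, 0 ≤ W y)
    (hW1 : ∑ y, W y = 1) (G : ι → Param d) (x : Param d) {η bias mse : ℝ} (hη : 0 < η)
    (hηl : l * η ≤ 1 / 2) (hl : 0 < l)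
    (hb : ‖∑ y, W y • (G y - gradient F x)‖ ^ 2 ≤ bias)
    (hv : ∑ y, W y * ‖G y - gradient F x‖ ^ 2 ≤ mse) :
    ∑ y, W y * F (x - η • G y) ≤
      F x - η / 4 * ‖gradient F x‖ ^ 2 + η * bias + l * η ^ 2 * mse := by
  set g := gradient F x
  set β := ∑ y, W y • (G y - g)
  have hstep : ∀ y, F (x - η • G y) ≤ F x - η * ‖g‖ ^ 2 + l * η ^ 2 * ‖g‖ ^ 2 -
      η * inner ℝ g (G y - g) + l * η ^ 2 * ‖G y - g‖ ^ 2 := by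
    intro y
    have h1 := hF.le_quadratic x (-(η • G y))
    rw [← sub_eq_add_neg, inner_neg_right, norm_neg, inner_smul_right, norm_smul, mul_pow,
      Real.norm_eq_abs, sq_abs] at h1
    have h2 : inner ℝ g (G y) = ‖g‖ ^ 2 + inner ℝ g (G y - g) := by
      rw [inner_sub_right, real_inner_self_eq_norm_sq]; ring
    have h3 : ‖G y‖ ^ 2 ≤ 2 * ‖g‖ ^ 2 + 2 * ‖G y - g‖ ^ 2 := by
      have h4 := norm_add_le g (G y - g)
      rw [add_sub_cancel] at h4
      have h5 := pow_le_pow_left₀ (norm_nonneg _) h4 2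
      nlinarith [sq_nonneg (‖g‖ - ‖G y - g‖)]
    have h4 := mul_le_mul_of_nonneg_left h3 (by positivity : 0 ≤ l / 2 * η ^ 2)
    change _ ≤ F x + -(η * inner ℝ g (G y)) + _ at h1
    rw [h2] at h1
    linarith
  have hinner : ∑ y, W y * inner ℝ g (G y - g) = inner ℝ g β := by
    simp only [β, inner_sum, inner_smul_right]
  -- Young's inequality spends a quarter of `‖g‖ ^ 2` on the bias. The second-order term below
  -- spends at most half, which leaves the `η / 4` of the conclusion.
  have hgb : -inner ℝ g β ≤ ‖g‖ ^ 2 / 4 + bias := by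
    have h1 := neg_le_of_abs_le (abs_real_inner_le_norm g β)
    nlinarith [sq_nonneg (‖g‖ / 2 - ‖β‖)]
  calc _ ≤ ∑ y, W y * (F x - η * ‖g‖ ^ 2 + l * η ^ 2 * ‖g‖ ^ 2 -
          η * inner ℝ g (G y - g) + l * η ^ 2 * ‖G y - g‖ ^ 2) :=
        Finset.sum_le_sum fun y _ => mul_le_mul_of_nonneg_left (hstep y) (hW y)
    _ = (∑ y, W y) * (F x - η * ‖g‖ ^ 2 + l * η ^ 2 * ‖g‖ ^ 2) -
          η * ∑ y, W y * inner ℝ g (G y - g) + l * η ^ 2 * ∑ y, W y * ‖G y - g‖ ^ 2 := by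
        simp only [mul_add, mul_sub, Finset.sum_add_distrib, Finset.sum_sub_distrib,
          ← Finset.sum_mul, Finset.mul_sum]
        congr 1
        · congr 1
          exact Finset.sum_congr rfl fun y _ => by ring
        · exact Finset.sum_congr rfl fun y _ => by ring
    _ ≤ _ := by
        rw [hW1, hinner, one_mul]
        have h1 := mul_le_mul_of_nonneg_left hv (by positivity : 0 ≤ l * η ^ 2)
        have h2 := mul_le_mul_of_nonneg_left hgb hη.le
        have h3 : l * η ^ 2 * ‖g‖ ^ 2 ≤ η / 2 * ‖g‖ ^ 2 :=
          mul_le_mul_of_nonneg_right (by nlinarith) (sq_nonneg _)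
        nlinarith

end Smooth

/-! ### The score, the gradient of the loss and its smoothness. -/

/-- The score function `∇ log p_θ(x)`. -/
abbrev score {n d : ℕ} (p : Param d → Cube n → ℝ) (θ : Param d) (x : Cube n) : Param d :=
  gradient (fun θ' => Real.log (p θ' x)) θ

namespace RegularPolicy

variable {n d : ℕ} {p : Param d → Cube n → ℝ} {M₁ M₂ M₃ : ℝ}

theorem hasGradientAt_log (hp : RegularPolicy p M₁ M₂ M₃) (x : Cube n) (θ : Param d) :
    HasGradientAt (fun θ' => Real.log (p θ' x)) (score p θ x) θ :=
  (hp.differentiable x θ).hasGradientAt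

/-- Regularity is assumed for `log p` only; positivity recovers `p` as its exponential. -/
theorem hasGradientAt (hp : RegularPolicy p M₁ M₂ M₃) (x : Cube n) (θ : Param d) :
    HasGradientAt (fun θ' => p θ' x) (p θ x • score p θ x) θ := by
  have h := (hp.hasGradientAt_log x θ).hasFDerivAt.exp
  simp only [Real.exp_log (hp.pos _ x)] at h
  rw [hasGradientAt_iff_hasFDerivAt]
  simpa using h

theorem le_one (hp : RegularPolicy p M₁ M₂ M₃) (x : Cube n) (θ : Param d) : p θ x ≤ 1 := by
  rw [← hp.sum_eq_one θ]
  exact Finset.single_le_sum (f := fun x => p θ x) (fun y _ => (hp.pos θ y).le)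
    (Finset.mem_univ x)

theorem exp_neg_le (hp : RegularPolicy p M₁ M₂ M₃) (x : Cube n) (θ : Param d) :
    Real.exp (-M₁) ≤ p θ x := by
  rw [← Real.le_log_iff_exp_le (hp.pos θ x)]
  exact (abs_le.1 (hp.abs_log_le x θ)).1

theorem nonneg_bounds (hp : RegularPolicy p M₁ M₂ M₃) : 0 ≤ M₁ ∧ 0 ≤ M₂ :=
  ⟨(abs_nonneg _).trans (hp.abs_log_le 1 0), (norm_nonneg _).trans (hp.norm_gradient_le 1 0)⟩

/-- This is the derivative of the constant total mass. -/
theorem sum_smul_score (hp : RegularPolicy p M₁ M₂ M₃) (θ : Param d) :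
    ∑ x, p θ x • score p θ x = 0 := by
  have h : HasFDerivAt (fun θ' => ∑ x, p θ' x)
      (∑ x, InnerProductSpace.toDual ℝ (Param d) (p θ x • score p θ x)) θ :=
    HasFDerivAt.fun_sum fun x _ => (hp.hasGradientAt x θ).hasFDerivAt
  simp only [hp.sum_eq_one] at h
  have h1 := h.unique (hasFDerivAt_const (1 : ℝ) θ)
  rw [← map_sum] at h1
  exact (LinearIsometryEquiv.map_eq_zero_iff _).1 h1

theorem hasGradientAt_loss (hp : RegularPolicy p M₁ M₂ M₃) (f : Cube n → ℝ)
    (T : Cube n → Cube n) (lam : ℝ) (θ : Param d) :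
    HasGradientAt (loss f T p lam)
      (∑ x, (p θ x * (f (T x) + lam * Real.log (p θ x))) • score p θ x) θ := by
  have h1 : ∀ x, HasFDerivAt (fun θ' => p θ' x) _ θ := fun x => (hp.hasGradientAt x θ).hasFDerivAt
  have h2 : ∀ x, HasFDerivAt (fun θ' => Real.log (p θ' x)) _ θ :=
    fun x => (hp.hasGradientAt_log x θ).hasFDerivAt
  have h3 := (HasFDerivAt.fun_sum (u := Finset.univ) fun x _ => (h1 x).mul_const (f (T x))).add
    ((HasFDerivAt.fun_sum (u := Finset.univ) fun x _ => (h1 x).mul (h2 x)).const_mul lam)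
  rw [hasGradientAt_iff_hasFDerivAt]
  refine h3.congr_fderiv ?_
  have h0 := congrArg (InnerProductSpace.toDual ℝ (Param d)) (hp.sum_smul_score θ)
  simp only [map_sum, map_smul, map_zero] at h0
  simp only [map_sum, map_smulₛₗ, RCLike.conj_to_real, Finset.smul_sum,
    ← Finset.sum_add_distrib, smul_smul, ← add_smul]
  -- Differentiating `p log p` produces an extra `λ p • score`, whose sum over `x` vanishes because
  -- the score is centred.
  have e : ∀ x, (f (T x) * p θ x + lam * (p θ x + Real.log (p θ x) * p θ x)) •
        InnerProductSpace.toDual ℝ (Param d) (score p θ x) =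
      (p θ x * (f (T x) + lam * Real.log (p θ x))) •
        InnerProductSpace.toDual ℝ (Param d) (score p θ x) +
      lam • (p θ x • InnerProductSpace.toDual ℝ (Param d) (score p θ x)) := fun x => by module
  simp only [e, Finset.sum_add_distrib, ← Finset.smul_sum, h0, smul_zero, add_zero]

theorem gradient_loss (hp : RegularPolicy p M₁ M₂ M₃) (f : Cube n → ℝ)
    (T : Cube n → Cube n) (lam : ℝ) (θ : Param d) :
    gradient (loss f T p lam) θ =
      ∑ x, (p θ x * (f (T x) + lam * Real.log (p θ x))) • score p θ x :=
  (hp.hasGradientAt_loss f T lam θ).gradient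

theorem abs_advantage_le (hp : RegularPolicy p M₁ M₂ M₃) {f : Cube n → ℝ}
    {T : Cube n → Cube n} {B lam : ℝ} (hB : ∀ x, |f (T x)| ≤ B) (hlam : 0 ≤ lam)
    (θ : Param d) (x : Cube n) : |f (T x) + lam * Real.log (p θ x)| ≤ B + lam * M₁ := by
  refine (abs_add_le _ _).trans (add_le_add (hB x) ?_)
  rw [abs_mul, abs_of_nonneg hlam]
  exact mul_le_mul_of_nonneg_left (hp.abs_log_le x θ) hlam

theorem isSmoothWith_loss (hp : RegularPolicy p M₁ M₂ M₃) {f : Cube n → ℝ}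
    {T : Cube n → Cube n} {B lam : ℝ} (hB : ∀ x, |f (T x)| ≤ B) (hlam : 0 ≤ lam) :
    IsSmoothWith (2 ^ n * (M₂ * (B + lam * M₁) * M₂ + lam * M₂ * M₂ + (B + lam * M₁) * M₃))
      (loss f T p lam) := by
  refine ⟨fun θ => (hp.hasGradientAt_loss f T lam θ).differentiableAt, fun θ₁ θ₂ => ?_⟩
  obtain ⟨hM₁, hM₂⟩ := hp.nonneg_bounds
  rw [hp.gradient_loss, hp.gradient_loss, ← Finset.sum_sub_distrib]
  have key : ∀ x, ‖(p θ₁ x * (f (T x) + lam * Real.log (p θ₁ x))) • score p θ₁ x -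
      (p θ₂ x * (f (T x) + lam * Real.log (p θ₂ x))) • score p θ₂ x‖ ≤
      (M₂ * (B + lam * M₁) * M₂ + lam * M₂ * M₂ + (B + lam * M₁) * M₃) * ‖θ₁ - θ₂‖ := by
    intro x
    -- The factors `p`, `f ∘ T + λ log p` and `score` are changed one at a time; each is bounded and
    -- Lipschitz.
    have e : (p θ₁ x * (f (T x) + lam * Real.log (p θ₁ x))) • score p θ₁ x -
        (p θ₂ x * (f (T x) + lam * Real.log (p θ₂ x))) • score p θ₂ x =
        ((p θ₁ x - p θ₂ x) * (f (T x) + lam * Real.log (p θ₁ x))) • score p θ₁ x +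
        (p θ₂ x * (lam * (Real.log (p θ₁ x) - Real.log (p θ₂ x)))) • score p θ₁ x +
        (p θ₂ x * (f (T x) + lam * Real.log (p θ₂ x))) • (score p θ₁ x - score p θ₂ x) := by
      module
    have hl1 := hp.abs_advantage_le hB hlam θ₁ x
    have hl2 := hp.abs_advantage_le hB hlam θ₂ x
    have hA : 0 ≤ B + lam * M₁ := (abs_nonneg _).trans hl1
    have hs1 := hp.norm_gradient_le x θ₁
    have hsub := hp.gradient_lipschitz x θ₁ θ₂
    have hlog := hasGradientAt_abs_sub_le (hp.hasGradientAt_log x) (hp.norm_gradient_le x) θ₁ θ₂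
    have hpp := hasGradientAt_abs_sub_le (hp.hasGradientAt x) (C := M₂) (fun θ => by
      rw [norm_smul, Real.norm_eq_abs, abs_of_pos (hp.pos θ x)]
      exact (mul_le_mul (hp.le_one x θ) (hp.norm_gradient_le x θ) (norm_nonneg _)
        zero_le_one).trans (one_mul _).le) θ₁ θ₂
    have hp2 : |p θ₂ x| ≤ 1 := by rw [abs_of_pos (hp.pos θ₂ x)]; exact hp.le_one x θ₂
    rw [e]
    refine norm_add₃_le.trans ?_
    simp only [norm_smul, Real.norm_eq_abs, abs_mul, abs_of_nonneg hlam]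
    calc _ ≤ M₂ * ‖θ₁ - θ₂‖ * (B + lam * M₁) * M₂ + 1 * (lam * (M₂ * ‖θ₁ - θ₂‖)) * M₂ +
          1 * (B + lam * M₁) * (M₃ * ‖θ₁ - θ₂‖) := by gcongr
      _ = _ := by ring
  calc _ ≤ ∑ _x : Cube n,
        (M₂ * (B + lam * M₁) * M₂ + lam * M₂ * M₂ + (B + lam * M₁) * M₃) * ‖θ₁ - θ₂‖ :=
        (norm_sum_le _ _).trans (Finset.sum_le_sum fun x _ => key x)
    _ = _ := by
        simp [mul_assoc]

end RegularPolicy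

/-! ### Bias and mean squared error of the policy gradient. -/

/-- The baseline is the same for all samples, so it factors out; this reduces the vector estimator
to the scalar one treated above. -/
theorem policyGradient_apply {n d k m b : ℕ} (f : Cube n → ℝ) (T : Cube n → Cube n)
    (p : Param d → Cube n → ℝ) (lam : ℝ) (θ : Param d) (y : Fin k → Fin (b + m) → Cube n)
    (c : Fin d) :
    policyGradient f T p lam θ (fun i (j : Fin m) => y i (Fin.natAdd b j)) c =
      retainedAvg (fun x => (f (T x) + lam * Real.log (p θ x)) * score p θ x c) y -
        retainedAvg (fun x => f (T x)) y * retainedAvg (fun x => score p θ x c) y := by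
  simp only [policyGradient, advantage, PiLp.smul_apply, WithLp.ofLp_sum, Finset.sum_apply,
    smul_eq_mul, retainedAvg, sub_mul, Finset.sum_sub_distrib]
  rw [mul_sub]
  congr 1
  simp only [← Finset.mul_sum]
  ring

/-- The constant in the bias of the policy gradient. -/
def biasConst (M₁ M₂ B lam γ : ℝ) : ℝ :=
  2 * (Real.exp M₁ / γ) * ((B + lam * M₁) * M₂) +
    4 * (Real.exp M₁ / γ) ^ 2 * (B ^ 2 + M₂ ^ 2) + 2 * (Real.exp M₁ / γ) * B * M₂

/-- The constant in the mean squared error of the policy gradient. -/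
def mseConst (M₁ M₂ B lam γ : ℝ) : ℝ :=
  8 * (Real.exp M₁ / γ) ^ 2 * (((B + lam * M₁) * M₂) ^ 2 + B ^ 2 * M₂ ^ 2)

section Estimator

variable {n d k m b : ℕ} {p : Param d → Cube n → ℝ} {M₁ M₂ M₃ B lam γ : ℝ}
  {f : Cube n → ℝ} {T : Cube n → Cube n} {Q : Matrix (Cube n) (Cube n) ℝ}

theorem RegularPolicy.isReversibleFor (hp : RegularPolicy p M₁ M₂ M₃) (hQ : IsProposal Q)
    (θ : Param d) : IsReversibleFor (p θ) (mhMatrix (p θ) Q) :=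
  isReversibleFor_mhMatrix (hp.pos θ) (hp.sum_eq_one θ) hQ

theorem RegularPolicy.abs_score_apply_le (hp : RegularPolicy p M₁ M₂ M₃) (θ : Param d)
    (c : Fin d) (x : Cube n) : |score p θ x c| ≤ M₂ :=
  (PiLp.norm_apply_le (score p θ x) c).trans (hp.norm_gradient_le x θ)

theorem RegularPolicy.abs_advantage_mul_score_le (hp : RegularPolicy p M₁ M₂ M₃)
    (hB : ∀ x, |f (T x)| ≤ B) (hlam : 0 ≤ lam) (θ : Param d) (c : Fin d) (x : Cube n) :
    |(f (T x) + lam * Real.log (p θ x)) * score p θ x c| ≤ (B + lam * M₁) * M₂ := by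
  have h := hp.abs_advantage_le hB hlam θ x
  rw [abs_mul]
  exact mul_le_mul h (hp.abs_score_apply_le θ c x) (abs_nonneg _) ((abs_nonneg _).trans h)

theorem RegularPolicy.sum_mul_score_apply (hp : RegularPolicy p M₁ M₂ M₃) (θ : Param d)
    (c : Fin d) : ∑ x, p θ x * score p θ x c = 0 := by
  have := congrArg (fun v : Param d => v c) (hp.sum_smul_score θ)
  simpa using this

theorem RegularPolicy.policyGradient_sub_gradient_apply (hp : RegularPolicy p M₁ M₂ M₃)
    (θ : Param d) (y : Fin k → Fin (b + m) → Cube n) (c : Fin d) :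
    (policyGradient f T p lam θ (fun i (j : Fin m) => y i (Fin.natAdd b j)) -
        gradient (loss f T p lam) θ) c =
      retainedAvg (fun x => (f (T x) + lam * Real.log (p θ x)) * score p θ x c) y -
        retainedAvg (fun x => f (T x)) y * retainedAvg (fun x => score p θ x c) y -
        ∑ z, p θ z * ((f (T z) + lam * Real.log (p θ z)) * score p θ z c) := by
  rw [PiLp.sub_apply, policyGradient_apply, hp.gradient_loss]
  simp [mul_assoc]

theorem RegularPolicy.norm_sq_bias_le (hp : RegularPolicy p M₁ M₂ M₃) (hQ : IsProposal Q)
    (hB : ∀ x, |f (T x)| ≤ B) (hlam : 0 ≤ lam) (hγ : 0 < γ) (θ : Param d)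
    (hg : γ ≤ spectralGap (mhMatrix (p θ) Q)) (hk : 1 ≤ k) (hm : 1 ≤ m) (s : Fin k → Cube n) :
    ‖∑ y, arrayProb (mhMatrix (p θ) Q) s (b + m) y •
      (policyGradient f T p lam θ (fun i (j : Fin m) => y i (Fin.natAdd b j)) -
        gradient (loss f T p lam) θ)‖ ^ 2 ≤ d * (biasConst M₁ M₂ B lam γ / m) ^ 2 := by
  rw [EuclideanSpace.real_norm_sq_eq]
  calc _ ≤ ∑ _c : Fin d, (biasConst M₁ M₂ B lam γ / m) ^ 2 := by
        refine Finset.sum_le_sum fun c _ => ?_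
        simp only [WithLp.ofLp_sum, Finset.sum_apply, PiLp.smul_apply, smul_eq_mul,
          hp.policyGradient_sub_gradient_apply]
        rw [← sq_abs]
        gcongr
        exact (hp.isReversibleFor hQ θ).abs_sum_arrayProb_mul_baseline_le hγ hg
          hp.nonneg_bounds.1 (fun x => hp.exp_neg_le x θ)
          (hp.abs_advantage_mul_score_le hB hlam θ c) hB (hp.abs_score_apply_le θ c)
          (hp.sum_mul_score_apply θ c) hk hm s
    _ = _ := by simp

theorem RegularPolicy.sum_mul_norm_sq_le (hp : RegularPolicy p M₁ M₂ M₃) (hQ : IsProposal Q)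
    (hB : ∀ x, |f (T x)| ≤ B) (hlam : 0 ≤ lam) (hγ : 0 < γ) (θ : Param d)
    (hg : γ ≤ spectralGap (mhMatrix (p θ) Q)) (hk : 1 ≤ k) (hm : 1 ≤ m) (s : Fin k → Cube n) :
    ∑ y, arrayProb (mhMatrix (p θ) Q) s (b + m) y *
      ‖policyGradient f T p lam θ (fun i (j : Fin m) => y i (Fin.natAdd b j)) -
        gradient (loss f T p lam) θ‖ ^ 2 ≤ d * (mseConst M₁ M₂ B lam γ * mseRate m k) := by
  simp only [EuclideanSpace.real_norm_sq_eq, Finset.mul_sum]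
  rw [Finset.sum_comm]
  calc _ ≤ ∑ _c : Fin d, mseConst M₁ M₂ B lam γ * mseRate m k := by
        refine Finset.sum_le_sum fun c _ => ?_
        simp only [hp.policyGradient_sub_gradient_apply]
        exact (hp.isReversibleFor hQ θ).sum_arrayProb_mul_baseline_sq_le hγ hg
          hp.nonneg_bounds.1 (fun x => hp.exp_neg_le x θ)
          (hp.abs_advantage_mul_score_le hB hlam θ c) hB (hp.abs_score_apply_le θ c)
          (hp.sum_mul_score_apply θ c) hk hm s
    _ = _ := by simp

theorem RegularPolicy.abs_loss_le (hp : RegularPolicy p M₁ M₂ M₃)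
    (hB : ∀ x, |f (T x)| ≤ B) (hlam : 0 ≤ lam) (θ : Param d) :
    |loss f T p lam θ| ≤ B + lam * M₁ := by
  have e : loss f T p lam θ = ∑ x, p θ x * (f (T x) + lam * Real.log (p θ x)) := by
    rw [loss, Finset.mul_sum, ← Finset.sum_add_distrib]
    exact Finset.sum_congr rfl fun x _ => by ring
  rw [e]
  calc _ ≤ ∑ x, p θ x * (B + lam * M₁) := (Finset.abs_sum_le_sum_abs _ _).trans
        (Finset.sum_le_sum fun x _ => by
          rw [abs_mul, abs_of_pos (hp.pos θ x)]
          exact mul_le_mul_of_nonneg_left (hp.abs_advantage_le hB hlam θ x) (hp.pos θ x).le)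
    _ = _ := by rw [← Finset.sum_mul, hp.sum_eq_one, one_mul]

theorem RegularPolicy.norm_gradient_loss_le (hp : RegularPolicy p M₁ M₂ M₃)
    (hB : ∀ x, |f (T x)| ≤ B) (hlam : 0 ≤ lam) (θ : Param d) :
    ‖gradient (loss f T p lam) θ‖ ≤ (B + lam * M₁) * M₂ := by
  rw [hp.gradient_loss]
  calc _ ≤ ∑ x, p θ x * ((B + lam * M₁) * M₂) := (norm_sum_le _ _).trans
        (Finset.sum_le_sum fun x _ => by
          have h := hp.abs_advantage_le hB hlam θ x
          rw [norm_smul, Real.norm_eq_abs, abs_mul, abs_of_pos (hp.pos θ x), mul_assoc]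
          exact mul_le_mul_of_nonneg_left (mul_le_mul h (hp.norm_gradient_le x θ)
            (norm_nonneg _) ((abs_nonneg _).trans h)) (hp.pos θ x).le)
    _ = _ := by rw [← Finset.sum_mul, hp.sum_eq_one, one_mul]

theorem RegularPolicy.continuous_policyGradient (hp : RegularPolicy p M₁ M₂ M₃)
    (S : Fin k → Fin m → Cube n) : Continuous (fun θ => policyGradient f T p lam θ S) := by
  have h1 : ∀ x, Continuous (fun θ => Real.log (p θ x)) := fun x => (hp.differentiable x).continuous
  have h2 : ∀ x, Continuous (fun θ => score p θ x) := fun x =>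
    (LipschitzWith.of_dist_le' (K := M₃) fun θ₁ θ₂ => by
      rw [dist_eq_norm, dist_eq_norm]
      exact hp.gradient_lipschitz x θ₁ θ₂).continuous
  unfold policyGradient advantage
  refine Continuous.fun_const_smul ?_ _
  refine continuous_finsetSum _ fun i _ => continuous_finsetSum _ fun j _ => ?_
  exact ((continuous_const.add (continuous_const.mul (h1 _))).sub continuous_const).smul (h2 _)

end Estimator

/-! ### Conditioning on the past and convergence of the run. -/

/-- Disintegration along the past: the conditional expectation of a bounded function of a
`ℱ`-measurable variable and a finitely valued one. -/
theorem integral_eq_integral_sum_of_condExp_indicator {Ω E ι : Type*} [mΩ : MeasurableSpace Ω]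
    {μ : Measure Ω} [IsProbabilityMeasure μ] {ℱ : MeasurableSpace Ω} (hℱ : ℱ ≤ mΩ)
    [MeasurableSpace E] [Fintype ι] {θ : Ω → E} (hθ : Measurable[ℱ] θ) {X : Ω → ι}
    (hX : ∀ y, MeasurableSet[mΩ] {ω | X ω = y}) {w : Ω → ι → ℝ}
    (hw : ∀ y, μ[Set.indicator {ω | X ω = y} (fun _ => (1 : ℝ)) | ℱ] =ᵐ[μ] fun ω => w ω y)
    {Φ : E → ι → ℝ} (hΦ : ∀ y, Measurable (fun e => Φ e y)) {R : ℝ} (hR : ∀ e y, |Φ e y| ≤ R) :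
    Integrable (fun ω => ∑ y, w ω y * Φ (θ ω) y) μ ∧
      ∫ ω, Φ (θ ω) (X ω) ∂μ = ∫ ω, ∑ y, w ω y * Φ (θ ω) y ∂μ := by
  classical
  have hm : ∀ y, Measurable[ℱ] (fun ω => Φ (θ ω) y) := fun y => (hΦ y).comp hθ
  have hI : ∀ y, Integrable (Set.indicator {ω | X ω = y} (fun _ => (1 : ℝ))) μ := fun y =>
    (integrable_const 1).indicator (hX y)
  -- The factor known from the past is pulled out of the conditional expectation. Integrability of
  -- the weighted terms is then inherited from the conditional expectation.
  have hc : ∀ y, μ[(fun ω => Φ (θ ω) y) * Set.indicator {ω | X ω = y} (fun _ => (1 : ℝ)) | ℱ]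
      =ᵐ[μ] fun ω => w ω y * Φ (θ ω) y := by
    intro y
    have h1 := condExp_stronglyMeasurable_mul_of_bound hℱ (μ := μ) (hm y).stronglyMeasurable (hI y) R
      (Filter.Eventually.of_forall fun ω => hR _ _)
    filter_upwards [h1, hw y] with ω h2 h3
    rw [h2, Pi.mul_apply, h3, mul_comm]
  have hint : ∀ y, Integrable (fun ω => w ω y * Φ (θ ω) y) μ := fun y =>
    integrable_condExp.congr (hc y)
  have hI2 : ∀ y, Integrable ((fun ω => Φ (θ ω) y) *
      Set.indicator {ω | X ω = y} (fun _ => (1 : ℝ))) μ := fun y =>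
    (hI y).bdd_mul ((hm y).mono hℱ le_rfl).aestronglyMeasurable
      (Filter.Eventually.of_forall fun ω => hR _ _)
  refine ⟨integrable_finsetSum _ fun y _ => hint y, ?_⟩
  rw [integral_finsetSum _ fun y _ => hint y]
  have e : ∀ ω, Φ (θ ω) (X ω) = ∑ y, ((fun ω => Φ (θ ω) y) *
      Set.indicator {ω | X ω = y} (fun _ => (1 : ℝ))) ω := by
    intro ω
    rw [Finset.sum_eq_single (X ω)]
    · simp
    · intro y _ hy
      simp [Set.indicator, hy.symm]
    · simp
  simp only [e]
  rw [integral_finsetSum _ fun y _ => hI2 y]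
  refine Finset.sum_congr rfl fun y _ => ?_
  rw [← integral_condExp hℱ]
  exact integral_congr_ae (hc y)

theorem IsSmoothWith.continuous_gradient {d : ℕ} {l : ℝ} {F : Param d → ℝ}
    (hF : IsSmoothWith l F) : Continuous (gradient F) :=
  (LipschitzWith.of_dist_le' (K := l) fun θ₁ θ₂ => by
    rw [dist_eq_norm, dist_eq_norm]
    exact hF.2 θ₁ θ₂).continuous

/-- The constant of the convergence rate for step sizes at most `1 / (2l)`. -/
def rateConst (d : ℕ) (M₁ M₂ B lam γ l : ℝ) : ℝ :=
  8 * |B + lam * M₁| + 4 * d * biasConst M₁ M₂ B lam γ ^ 2 +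
    4 * l * d * mseConst M₁ M₂ B lam γ + 2 * d * mseConst M₁ M₂ B lam γ

theorem mseConst_nonneg (M₁ M₂ B lam γ : ℝ) : 0 ≤ mseConst M₁ M₂ B lam γ := by
  unfold mseConst; positivity

theorem rateConst_nonneg (d : ℕ) (M₁ M₂ B lam γ : ℝ) {l : ℝ} (hl : 0 < l) :
    0 ≤ rateConst d M₁ M₂ B lam γ l := by
  have := mseConst_nonneg M₁ M₂ B lam γ
  unfold rateConst; positivity

section Run

variable {n d k m b : ℕ} {p : Param d → Cube n → ℝ} {M₁ M₂ M₃ B lam γ l : ℝ}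
  {f : Cube n → ℝ} {T : Cube n → Cube n} {Q : Matrix (Cube n) (Cube n) ℝ} {η : ℕ → ℝ}
  {Ω : Type*} [mΩ : MeasurableSpace Ω] {μ : Measure Ω} [IsProbabilityMeasure μ]
  {ℱ : Filtration ℕ mΩ} {θ : ℕ → Ω → Param d} {s : ℕ → Ω → Fin k → Cube n}
  {X : ℕ → Ω → Fin k → Fin (b + m) → Cube n}

/-- Expected decrease of the loss in one iteration of MCPG. -/
theorem IsMCPGRun.integral_loss_succ_le (h : IsMCPGRun f T p lam Q k m b η μ ℱ θ s X)
    (hp : RegularPolicy p M₁ M₂ M₃) (hB : ∀ x, |f (T x)| ≤ B) (hlam : 0 ≤ lam)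
    (hL : IsSmoothWith l (loss f T p lam)) (hl : 0 < l) (hQ : IsProposal Q) (hγ : 0 < γ)
    (hg : ∀ θ, γ ≤ spectralGap (mhMatrix (p θ) Q)) (hk : 1 ≤ k) (hm : 1 ≤ m) {t : ℕ}
    (ht : 1 ≤ t) (hη : 0 < η t) (hηl : l * η t ≤ 1 / 2) :
    ∫ ω, loss f T p lam (θ (t + 1) ω) ∂μ ≤ ∫ ω, loss f T p lam (θ t ω) ∂μ -
      η t / 4 * ∫ ω, ‖gradient (loss f T p lam) (θ t ω)‖ ^ 2 ∂μ +
      η t * (d * (biasConst M₁ M₂ B lam γ / m) ^ 2) +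
      l * η t ^ 2 * (d * (mseConst M₁ M₂ B lam γ * mseRate m k)) := by
  set L := loss f T p lam
  have hLc : Continuous L := hL.1.continuous
  have hθ : Measurable (θ t) := (h.measurable_param t ht).mono (ℱ.le t) le_rfl
  obtain ⟨hI, hE⟩ := integral_eq_integral_sum_of_condExp_indicator (μ := μ) (ℱ.le t)
    (h.measurable_param t ht) (fun y => ℱ.le (t + 1) _ (h.measurable_chains t ht y))
    (w := fun ω y => arrayProb (mhMatrix (p (θ t ω)) Q) (s t ω) (b + m) y)
    (h.chains_law t ht)
    (Φ := fun e y => L (e - η t • policyGradient f T p lam e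
      (fun i (j : Fin m) => y i (Fin.natAdd b j))))
    (fun y => (hLc.comp (continuous_id.sub
      ((hp.continuous_policyGradient _).const_smul (η t)))).measurable)
    (fun e y => hp.abs_loss_le hB hlam _)
  have hIL : Integrable (fun ω => L (θ t ω)) μ :=
    Integrable.of_bound (hLc.measurable.comp hθ).aestronglyMeasurable (B + lam * M₁)
      (Filter.Eventually.of_forall fun ω => hp.abs_loss_le hB hlam _)
  have hIg : Integrable (fun ω => ‖gradient L (θ t ω)‖ ^ 2) μ :=
    Integrable.of_bound ((hL.continuous_gradient.norm.pow 2).measurable.comp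
      hθ).aestronglyMeasurable (((B + lam * M₁) * M₂) ^ 2)
      (Filter.Eventually.of_forall fun ω => by
        rw [norm_pow, norm_norm]
        exact pow_le_pow_left₀ (norm_nonneg _) (hp.norm_gradient_loss_le hB hlam _) 2)
  simp only [h.update t ht]
  rw [hE]
  have hI1 : Integrable (fun ω => L (θ t ω) - η t / 4 * ‖gradient L (θ t ω)‖ ^ 2) μ :=
    hIL.sub (hIg.const_mul _)
  calc _ ≤ ∫ ω, (L (θ t ω) - η t / 4 * ‖gradient L (θ t ω)‖ ^ 2 +
        (η t * (d * (biasConst M₁ M₂ B lam γ / m) ^ 2) +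
        l * η t ^ 2 * (d * (mseConst M₁ M₂ B lam γ * mseRate m k)))) ∂μ := by
        refine integral_mono hI (hI1.add (integrable_const _)) fun ω => ?_
        have hr := hp.isReversibleFor hQ (θ t ω)
        have := hL.sum_mul_step_le (arrayProb_nonneg hr.nonneg (s t ω) (b + m))
          (sum_arrayProb hr.sum_row (s t ω) (b + m))
          (fun y => policyGradient f T p lam (θ t ω) (fun i (j : Fin m) => y i (Fin.natAdd b j)))
          (θ t ω) hη hηl hl
          (hp.norm_sq_bias_le hQ hB hlam hγ (θ t ω) (hg _) hk hm (s t ω))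
          (hp.sum_mul_norm_sq_le hQ hB hlam hγ (θ t ω) (hg _) hk hm (s t ω))
        linarith
    _ = _ := by
        rw [integral_add hI1 (integrable_const _), integral_sub hIL (hIg.const_mul _),
          integral_const_mul, integral_const]
        simp
        ring

/-- Convergence rate over a window `a ≤ t ≤ τ` of iterations with small step sizes. -/
theorem IsMCPGRun.minExpSqGrad_le_of_window (h : IsMCPGRun f T p lam Q k m b η μ ℱ θ s X)
    (hp : RegularPolicy p M₁ M₂ M₃) (hB : ∀ x, |f (T x)| ≤ B) (hlam : 0 ≤ lam)
    (hL : IsSmoothWith l (loss f T p lam)) (hl : 0 < l) (hQ : IsProposal Q) (hγ : 0 < γ)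
    (hg : ∀ θ, γ ≤ spectralGap (mhMatrix (p θ) Q)) (hk : 1 ≤ k) (hm : 1 ≤ m) {a τ : ℕ}
    (hτ : 1 ≤ τ) (ha : 1 ≤ a) (haτ : a ≤ τ)
    (hη : ∀ t ∈ Finset.Icc a τ, 0 < η t ∧ η t ≤ 1 / (2 * l)) :
    minExpSqGrad (loss f T p lam) μ θ τ hτ ≤
      rateConst d M₁ M₂ B lam γ l * (1 / (∑ t ∈ Finset.Icc a τ, η t)
        + (∑ t ∈ Finset.Icc a τ, η t ^ 2) / ((m : ℝ) * k * ∑ t ∈ Finset.Icc a τ, η t)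
        + 1 / (m : ℝ) ^ 2) := by
  have hk0 : (0 : ℝ) < k := by exact_mod_cast hk
  have hm0 : (0 : ℝ) < m := by exact_mod_cast hm
  have hηl : ∀ t ∈ Finset.Icc a τ, l * η t ≤ 1 / 2 := fun t ht => by
    have := mul_le_mul_of_nonneg_left (hη t ht).2 hl.le
    refine this.trans (le_of_eq ?_)
    field_simp
  set v := minExpSqGrad (loss f T p lam) μ θ τ hτ with hv
  set Λ : ℕ → ℝ := fun t => ∫ ω, loss f T p lam (θ t ω) ∂μ with hΛ
  have hΛb : ∀ t, |Λ t| ≤ |B + lam * M₁| := fun t => by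
    have := norm_integral_le_of_norm_le_const (μ := μ) (f := fun ω => loss f T p lam (θ t ω))
      (Filter.Eventually.of_forall fun ω => hp.abs_loss_le hB hlam (θ t ω))
    simp only [probReal_univ, mul_one, Real.norm_eq_abs] at this
    exact this.trans (le_abs_self _)
  set bC := d * (biasConst M₁ M₂ B lam γ / m) ^ 2 with hbC
  set C₂ := d * mseConst M₁ M₂ B lam γ with hC₂
  have hC₂0 : 0 ≤ C₂ := mul_nonneg (Nat.cast_nonneg d) (mseConst_nonneg _ _ _ _ _)
  have hstep : ∀ t ∈ Finset.Icc a τ, η t * v / 4 ≤ (Λ t - Λ (t + 1)) + (η t * bC +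
      l * C₂ * η t ^ 2 / (m * k) + η t * (C₂ / (2 * m ^ 2))) := by
    intro t ht
    obtain ⟨h1, h2⟩ := Finset.mem_Icc.1 ht
    have hs := h.integral_loss_succ_le hp hB hlam hL hl hQ hγ hg hk hm (ha.trans h1)
      (hη t ht).1 (hηl t ht)
    have hmin : v ≤ ∫ ω, ‖gradient (loss f T p lam) (θ t ω)‖ ^ 2 ∂μ :=
      Finset.inf'_le (fun t => ∫ ω, ‖gradient (loss f T p lam) (θ t ω)‖ ^ 2 ∂μ)
        (Finset.mem_Icc.2 ⟨ha.trans h1, h2⟩)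
    have h3 := mul_le_mul_of_nonneg_left hmin (hη t ht).1.le
    -- Only the `1/(mk)` part of the error keeps `η t ^ 2`; in the `1/m²` part one factor `l * η t`
    -- is bounded by `1/2`.
    have h4 : l * η t ^ 2 * (d * (mseConst M₁ M₂ B lam γ * mseRate m k)) ≤
        l * C₂ * η t ^ 2 / (m * k) + η t * (C₂ / (2 * m ^ 2)) := by
      calc _ = l * C₂ * η t ^ 2 / (m * k) + (l * η t) * (η t * (C₂ / m ^ 2)) := by
            rw [mseRate, hC₂]; field_simp
        _ ≤ l * C₂ * η t ^ 2 / (m * k) + 1 / 2 * (η t * (C₂ / m ^ 2)) := by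
            have := (hη t ht).1
            gcongr
            exact hηl t ht
        _ = _ := by ring
    simp only [hΛ]
    linarith
  have hsum := Finset.sum_le_sum hstep
  have htel : ∑ t ∈ Finset.Icc a τ, (Λ t - Λ (t + 1)) = Λ a - Λ (τ + 1) := by
    have := Finset.sum_Ico_sub Λ (Nat.le_succ_of_le haτ)
    rw [← neg_sub, ← this, ← Finset.sum_neg_distrib]
    simp only [neg_sub, Nat.succ_eq_add_one, Finset.Ico_add_one_right_eq_Icc]
  set S := ∑ t ∈ Finset.Icc a τ, η t with hS
  set S₂ := ∑ t ∈ Finset.Icc a τ, η t ^ 2 with hS₂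
  have hSpos : 0 < S := Finset.sum_pos (fun t ht => (hη t ht).1) (Finset.nonempty_Icc.2 haτ)
  have hS₂0 : 0 ≤ S₂ := Finset.sum_nonneg fun t _ => sq_nonneg _
  simp only [Finset.sum_add_distrib, htel, ← Finset.sum_div, ← Finset.sum_mul, ← Finset.mul_sum,
    ← hS, ← hS₂] at hsum
  have hΛd : Λ a - Λ (τ + 1) ≤ 2 * |B + lam * M₁| := by
    linarith [(abs_le.1 (hΛb a)).2, (abs_le.1 (hΛb (τ + 1))).1]
  have hfin : v ≤ 8 * |B + lam * M₁| * (1 / S) + (4 * d * biasConst M₁ M₂ B lam γ ^ 2 + 2 * C₂) *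
      (1 / m ^ 2) + 4 * l * C₂ * (S₂ / (m * k * S)) := by
    have h1 : S * v / 4 ≤ 2 * |B + lam * M₁| + (S * bC + l * C₂ * S₂ / (m * k) +
      S * (C₂ / (2 * m ^ 2))) := by linarith
    have h2 : v ≤ (2 * |B + lam * M₁| + (S * bC + l * C₂ * S₂ / (m * k) +
      S * (C₂ / (2 * m ^ 2)))) * 4 / S := by
      rw [le_div_iff₀ hSpos]; linarith
    refine h2.trans (le_of_eq ?_)
    rw [hbC]
    field_simp
    ring
  have e1 : 0 ≤ 1 / S := by positivity
  have e2 : 0 ≤ S₂ / (m * k * S) := by positivity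
  have e3 : 0 ≤ 1 / (m : ℝ) ^ 2 := by positivity
  have hR : rateConst d M₁ M₂ B lam γ l = 8 * |B + lam * M₁| +
      (4 * d * biasConst M₁ M₂ B lam γ ^ 2 + 2 * C₂) + 4 * l * C₂ := by
    rw [rateConst, hC₂]; ring
  have p1 : 0 ≤ 8 * |B + lam * M₁| := by positivity
  have p2 : 0 ≤ 4 * d * biasConst M₁ M₂ B lam γ ^ 2 + 2 * C₂ := by positivity
  have p3 : 0 ≤ 4 * l * C₂ := by positivity
  rw [hR]
  refine hfin.trans ?_
  have q1 := mul_le_mul_of_nonneg_right (by linarith : 8 * |B + lam * M₁| ≤ 8 * |B + lam * M₁| +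
      (4 * d * biasConst M₁ M₂ B lam γ ^ 2 + 2 * C₂) + 4 * l * C₂) e1
  have q2 := mul_le_mul_of_nonneg_right (by linarith : 4 * l * C₂ ≤ 8 * |B + lam * M₁| +
      (4 * d * biasConst M₁ M₂ B lam γ ^ 2 + 2 * C₂) + 4 * l * C₂) e2
  have q3 := mul_le_mul_of_nonneg_right (by linarith : 4 * d * biasConst M₁ M₂ B lam γ ^ 2 + 2 * C₂
    ≤ 8 * |B + lam * M₁| + (4 * d * biasConst M₁ M₂ B lam γ ^ 2 + 2 * C₂) + 4 * l * C₂) e3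
  linarith

/-- Convergence rate for step sizes proportional to `1 / √t`. -/
theorem IsMCPGRun.minExpSqGrad_le_of_sqrt (h : IsMCPGRun f T p lam Q k m b η μ ℱ θ s X)
    (hp : RegularPolicy p M₁ M₂ M₃) (hB : ∀ x, |f (T x)| ≤ B) (hlam : 0 ≤ lam)
    (hL : IsSmoothWith l (loss f T p lam)) (hl : 0 < l) (hQ : IsProposal Q) (hγ : 0 < γ)
    (hg : ∀ θ, γ ≤ spectralGap (mhMatrix (p θ) Q)) (hk : 1 ≤ k) (hm : 1 ≤ m) {c : ℝ}
    (hc : 0 < c) (hη : ∀ t : ℕ, 1 ≤ t → η t = c * √((m : ℝ) * k) / √t) {τ : ℕ} (hτ : 1 ≤ τ)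
    (hτ2 : 2 ≤ τ) (hlarge : 8 * l ^ 2 * c ^ 2 * ((m : ℝ) * k) ≤ τ) :
    minExpSqGrad (loss f T p lam) μ θ τ hτ ≤
      rateConst d M₁ M₂ B lam γ l * (4 / c + 8 * c + 1) *
        (Real.log τ / √((m : ℝ) * k * τ) + 1 / (m : ℝ) ^ 2) := by
  have hk0 : (0 : ℝ) < k := by exact_mod_cast hk
  have hm0 : (0 : ℝ) < m := by exact_mod_cast hm
  have hτ0 : (0 : ℝ) < τ := by exact_mod_cast hτ
  have hmk : (0 : ℝ) < m * k := mul_pos hm0 hk0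
  -- The window starts at `⌈τ/2⌉`: it contains at least `τ/2` iterations, and `t ≥ τ/2` throughout.
  set a := (τ + 1) / 2 with ha_def
  have ha1 : 1 ≤ a := by omega
  have haτ : a ≤ τ := by omega
  have hat : ∀ t ∈ Finset.Icc a τ, (τ : ℝ) ≤ 2 * t ∧ (t : ℝ) ≤ τ ∧ 1 ≤ t := fun t ht => by
    obtain ⟨h1, h2⟩ := Finset.mem_Icc.1 ht
    exact ⟨by exact_mod_cast (by omega : τ ≤ 2 * t), by exact_mod_cast h2, ha1.trans h1⟩
  have hsq : ∀ t ∈ Finset.Icc a τ, η t ^ 2 ≤ 2 * c ^ 2 * (m * k) / τ := fun t ht => by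
    obtain ⟨h1, _, h3⟩ := hat t ht
    have ht0 : (0 : ℝ) < t := by exact_mod_cast h3
    rw [hη t h3, div_pow, mul_pow, Real.sq_sqrt hmk.le, Real.sq_sqrt ht0.le,
      div_le_div_iff₀ ht0 hτ0]
    have : 0 ≤ c ^ 2 * (m * k : ℝ) := by positivity
    nlinarith
  have hpos : ∀ t ∈ Finset.Icc a τ, 0 < η t := fun t ht => by
    have h3 := (hat t ht).2.2
    rw [hη t h3]
    have ht0 : (0 : ℝ) < t := by exact_mod_cast h3
    positivity
  -- Squared, the requirement is `2 c² mk / τ ≤ 1/(4 l²)`, which is exactly the lower bound assumed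
  -- on `τ`.
  have hsmall : ∀ t ∈ Finset.Icc a τ, 0 < η t ∧ η t ≤ 1 / (2 * l) := fun t ht => by
    refine ⟨hpos t ht, abs_le_of_sq_le_sq' ((hsq t ht).trans ?_) (by positivity) |>.2⟩
    rw [div_pow, mul_pow, one_pow, div_le_div_iff₀ hτ0 (by positivity)]
    nlinarith
  have hmain := h.minExpSqGrad_le_of_window hp hB hlam hL hl hQ hγ hg hk hm hτ ha1 haτ hsmall
  set S := ∑ t ∈ Finset.Icc a τ, η t with hS
  set S₂ := ∑ t ∈ Finset.Icc a τ, η t ^ 2 with hS₂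
  set w := √((m : ℝ) * k * τ) with hw
  have hw0 : 0 < w := by positivity
  have hww : √((m : ℝ) * k) * √τ = w := (Real.sqrt_mul hmk.le _).symm
  have hcard1 : (τ : ℝ) ≤ 2 * ((Finset.Icc a τ).card : ℝ) := by
    rw [Nat.card_Icc]; exact_mod_cast (by omega : τ ≤ 2 * (τ + 1 - a))
  have hcard2 : ((Finset.Icc a τ).card : ℝ) ≤ τ := by
    rw [Nat.card_Icc]; exact_mod_cast (by omega : τ + 1 - a ≤ τ)
  -- Every step in the window is at least the last one, `c √(mk) / √τ`.
  have hSlow : c * w / 2 ≤ S := by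
    have h1 : (Finset.Icc a τ).card • (c * √((m : ℝ) * k) / √τ) ≤ S :=
      Finset.card_nsmul_le_sum _ _ _ fun t ht => by
        obtain ⟨_, h2, h3⟩ := hat t ht
        have ht0 : (0 : ℝ) < t := by exact_mod_cast h3
        rw [hη t h3]
        gcongr
    refine le_trans ?_ h1
    rw [nsmul_eq_mul]
    calc c * w / 2 = (τ / 2) * (c * √((m : ℝ) * k) / √τ) := by
          have h2 : (τ : ℝ) = √τ * √τ := (Real.mul_self_sqrt hτ0.le).symm
          have h3 : 0 < √(τ : ℝ) := Real.sqrt_pos.2 hτ0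
          rw [← hww]
          nth_rewrite 2 [h2]
          field_simp
      _ ≤ _ := by gcongr; linarith
  have hS₂up : S₂ ≤ 2 * c ^ 2 * (m * k) := by
    refine (Finset.sum_le_card_nsmul _ _ _ hsq).trans ?_
    rw [nsmul_eq_mul]
    calc _ ≤ (τ : ℝ) * (2 * c ^ 2 * (m * k) / τ) := by gcongr
      _ = _ := by field_simp
  have hcw : 0 < c * w / 2 := by positivity
  have hSpos : 0 < S := hcw.trans_le hSlow
  have b1 : 1 / S ≤ 2 / c * (1 / w) := by
    refine (one_div_le_one_div_of_le hcw hSlow).trans (le_of_eq ?_)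
    field_simp
  have b2 : S₂ / (m * k * S) ≤ 4 * c * (1 / w) := by
    calc _ ≤ 2 * c ^ 2 * (m * k) / (m * k * (c * w / 2)) := by gcongr
      _ = _ := by field_simp; ring
  -- From `τ ≥ 2` and `log 2 > 1/2`; this replaces `1 / w` by `2 log τ / w` and doubles the
  -- constants `2 / c` and `4 c`.
  have hlog : 1 ≤ 2 * Real.log τ := by
    have := Real.log_le_log (by norm_num) (by exact_mod_cast hτ2 : (2 : ℝ) ≤ τ)
    linarith [Real.log_two_gt_d9]
  have b3 : 1 / w ≤ 2 * (Real.log τ / w) := by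
    rw [← mul_div_assoc]
    gcongr
  have hC := rateConst_nonneg d M₁ M₂ B lam γ hl
  refine hmain.trans ?_
  rw [mul_assoc (rateConst d M₁ M₂ B lam γ l)]
  refine mul_le_mul_of_nonneg_left ?_ hC
  have hlw : 0 ≤ Real.log τ / w := div_nonneg (by linarith) hw0.le
  have hm2 : 0 ≤ 1 / (m : ℝ) ^ 2 := by positivity
  have hc4 : 0 ≤ 4 / c + 8 * c := by positivity
  have b4 : (2 / c + 4 * c) * (1 / w) ≤ (2 / c + 4 * c) * (2 * (Real.log τ / w)) := by gcongr
  have b5 : (2 / c + 4 * c) * (2 * (Real.log τ / w)) = (4 / c + 8 * c) * (Real.log τ / w) := by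
    ring
  have b6 := mul_nonneg hc4 hm2
  rw [add_mul, one_mul, mul_add]
  linarith

end Run

/-! ### The main theorem. -/

theorem mainTheorem1 (n d : ℕ) (M₁ M₂ M₃ B lam γ : ℝ) (hM₁ : 0 < M₁) (hM₂ : 0 < M₂)
    (hM₃ : 0 < M₃) (hlam : 0 ≤ lam) (hγ : 0 < γ) :
    (∃ l : ℝ, 0 < l ∧
      ∀ (f : Cube n → ℝ) (T : Cube n → Cube n) (p : Param d → Cube n → ℝ),
        RegularPolicy p M₁ M₂ M₃ → (∀ x, |f (T x)| ≤ B) → IsSmoothWith l (loss f T p lam)) ∧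
    ∀ l : ℝ, 0 < l → ∃ (C : ℝ) (K : ℝ → ℝ),
      ∀ (f : Cube n → ℝ) (T : Cube n → Cube n) (p : Param d → Cube n → ℝ)
        (Q : Matrix (Cube n) (Cube n) ℝ),
        RegularPolicy p M₁ M₂ M₃ → (∀ x, |f (T x)| ≤ B) → IsSmoothWith l (loss f T p lam) →
        IsProposal Q → (∀ θ, γ ≤ spectralGap (mhMatrix (p θ) Q)) →
        ∀ (k m b : ℕ), 1 ≤ k → 1 ≤ m →
        ∀ (η : ℕ → ℝ) {Ω : Type*} [mΩ : MeasurableSpace Ω] (μ : Measure Ω)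
          [IsProbabilityMeasure μ] (ℱ : Filtration ℕ mΩ) (θ : ℕ → Ω → Param d)
          (s : ℕ → Ω → Fin k → Cube n) (X : ℕ → Ω → Fin k → Fin (b + m) → Cube n),
          IsMCPGRun f T p lam Q k m b η μ ℱ θ s X →
          ((∀ t, 1 ≤ t → 0 < η t ∧ η t ≤ 1 / (2 * l)) →
            ∀ (τ : ℕ) (hτ : 1 ≤ τ),
              minExpSqGrad (loss f T p lam) μ θ τ hτ ≤
                C * (1 / (∑ t ∈ Finset.Icc 1 τ, η t)
                  + (∑ t ∈ Finset.Icc 1 τ, η t ^ 2) /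
                      ((m : ℝ) * k * ∑ t ∈ Finset.Icc 1 τ, η t)
                  + 1 / (m : ℝ) ^ 2)) ∧
          (∀ c : ℝ, 0 < c → c ≤ 1 / (2 * l) →
            (∀ t : ℕ, 1 ≤ t → η t = c * Real.sqrt ((m : ℝ) * k) / Real.sqrt t) →
            ∀ (τ : ℕ) (hτ : 1 ≤ τ), 2 ≤ τ → 8 * l ^ 2 * c ^ 2 * ((m : ℝ) * k) ≤ τ →
              minExpSqGrad (loss f T p lam) μ θ τ hτ ≤
                K c * (Real.log τ / Real.sqrt ((m : ℝ) * k * τ) + 1 / (m : ℝ) ^ 2)) := by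
  -- The absolute value plus one makes the constant positive before any `f` is given, when the sign
  -- of `B` is not yet known.
  refine ⟨⟨|2 ^ n * (M₂ * (B + lam * M₁) * M₂ + lam * M₂ * M₂ + (B + lam * M₁) * M₃)| + 1,
    by positivity, fun f T p hp hB => ?_⟩, fun l hl =>
    ⟨rateConst d M₁ M₂ B lam γ l, fun c => rateConst d M₁ M₂ B lam γ l * (4 / c + 8 * c + 1),
      fun f T p Q hp hB hL hQ hg k m b hk hm η Ω mΩ μ _ ℱ θ s X h => ⟨fun hη τ hτ => ?_,
        fun c hc _ hη τ hτ hτ2 hlarge => ?_⟩⟩⟩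
  · have hs := hp.isSmoothWith_loss hB hlam
    exact ⟨hs.1, fun θ₁ θ₂ => (hs.2 θ₁ θ₂).trans (mul_le_mul_of_nonneg_right
      ((le_abs_self _).trans (le_add_of_nonneg_right zero_le_one)) (norm_nonneg _))⟩
  · exact h.minExpSqGrad_le_of_window hp hB hlam hL hl hQ hγ hg hk hm hτ le_rfl hτ
      fun t ht => hη t (Finset.mem_Icc.1 ht).1
  · exact h.minExpSqGrad_le_of_sqrt hp hB hlam hL hl hQ hγ hg hk hm hc hη hτ hτ2 hlarge

end
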